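/- Let $\mathbf G$ be a connected semisimple algebraic group over an algebraically closed field, $\mathbf T$ a maximal torus of $\mathbf G$, and let $(X,\Phi,Y,\Phi^\vee)$ be the root datum of $(\mathbf G,\mathbf T)$. All notions below depend only on this root datum, and the result is stated for every reduced semisimple root datum (that is, $X$ and $Y$ are finitely generated free abelian groups in perfect duality $\langle\,,\rangle$, and $\Phi$ is finite, reduced and spans a subgroup of finite index in $X$). Let $V=\mathbb Q\otimes_{\mathbb Z}Y\supset Y$, extend $\langle\,,\rangle$ to $V$, let $W$ be the Weyl group acting on $V$ and on $\Phi$, let $\Delta$ be a basis of $\Phi$, with positive roots $\Phi^+$, and let $(\varpi^\vee_\alpha)_{\alpha\in\Delta}$ be the basis of $V$ dual to $\Delta$. Let $\Phi_1,\dots,\Phi_r$ be the irreducible components of $\Phi$, $W_i$ the Weyl group of $\Phi_i$, $\Delta_i=\Delta\cap\Phi_i$, $\tilde\alpha_i=\sum_{\alpha\in\Delta_i}n_\alpha\alpha$ the highest root of $\Phi_i$, $\tilde\Delta_i=\Delta_i\cup\{-\tilde\alpha_i\}$ and $\tilde\Delta=\bigcup_i\tilde\Delta_i$. Put $n_{-\tilde\alpha_i}=1$,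 $\varpi^\vee_{-\tilde\alpha_i}=0$, $m_{-\tilde\alpha_i}=-1$, and $m_\alpha=0$ for $\alpha\in\Delta$. Let $$\mathcal C=\{\lambda\in V\mid\langle\alpha,\lambda\rangle\ge m_\alpha\text{ for all }\alpha\in\tilde\Delta\}.$$ The affine coordinates of $\lambda\in V$ are the unique family $(\lambda_\alpha)_{\alpha\in\tilde\Delta}$ of rational numbers such that $\sum_{\alpha\in\tilde\Delta_i}\lambda_\alpha=1$ for every $i$ and $\lambda=\sum_{\alpha\in\tilde\Delta}\frac{\lambda_\alpha}{n_\alpha}\varpi^\vee_\alpha$. For $\alpha\in\tilde\Delta_i$ with $n_\alpha=1$, let $\Phi_\alpha$ be the subsystem of $\Phi_i$ with basis $\Delta_i\setminus\{\alpha\}$, let $\Phi_\alpha^+=\Phi_\alpha\cap\Phi^+$, let $w_\alpha$ be the element of the Weyl group of $\Phi_\alpha$ such that $w_\alpha(\Phi_\alpha^+)=-\Phi_\alpha^+$, and let $z_\alpha=w_\alpha w_{-\tilde\alpha_i}\in W_i$. Let $\mathcal A=\{z\in W\mid z(\tilde\Delta)=\tilde\Delta\}$. Every $z\in\mathcal A$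 is uniquely a product $z_{\alpha_1}\cdots z_{\alpha_r}$ with $\alpha_i\in\tilde\Delta_i$ and $n_{\alpha_i}=1$; put $\varpi^\vee(z)=\sum_i\varpi^\vee_{\alpha_i}$ and $\mathcal A_{\mathbf G}=\{z\in\mathcal A\mid\varpi^\vee(z)\in Y\}$. For $\lambda\in V$ let $\Phi(\lambda)=\{\alpha\in\Phi\mid\langle\alpha,\lambda\rangle\in\mathbb Z\}$, let $W^\circ(\lambda)$ be the Weyl group of $\Phi(\lambda)$, and let $W_{\mathbf G}(\lambda)=\{w\in W\mid w(\lambda)-\lambda\in Y\}$. One says that $\lambda$ is $\mathbf G$-isolated (respectively $\mathbf G$-quasi-isolated) if $W^\circ(\lambda)$ (respectively $W_{\mathbf G}(\lambda)$) is not contained in a proper parabolic subgroup of $W$. Let $\lambda\in\mathcal C$. Then its affine coordinates exist and are unique, and with $$I_\lambda=\{\alpha\in\tilde\Delta\mid\lambda_\alpha=0\}$$ the following hold. 1. $I_\lambda=\{\alpha\in\tilde\Delta\mid\langle\alpha,\lambda\rangle=m_\alpha\}$, and $I_\lambda$ is a basis of $\Phi(\lambda)$. 2. Let $\Phi^+(\lambda)$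 be the positive system of $\Phi(\lambda)$ associated with the basis $I_\lambda$, and let $A_{\mathbf G}(\lambda)=\{w\in W_{\mathbf G}(\lambda)\mid w(\Phi^+(\lambda))=\Phi^+(\lambda)\}$. Then $$A_{\mathbf G}(\lambda)=\{z\in\mathcal A_{\mathbf G}\mid\lambda_{z(\alpha)}=\lambda_\alpha\text{ for all }\alpha\in\tilde\Delta\}.$$ 3. $\lambda$ is $\mathbf G$-isolated if and only if $|\tilde\Delta_i\setminus I_\lambda|=1$ for every $i\in\{1,\dots,r\}$. 4. $\lambda$ is $\mathbf G$-quasi-isolated if and only if $A_{\mathbf G}(\lambda)$ acts transitively on $\tilde\Delta_i\setminus I_\lambda$ for every $i\in\{1,\dots,r\}$. -/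

import Mathlib

open scoped TensorProduct Pointwise

noncomputable section

namespace QuasiIsolated

variable {ι X Y : Type*} [AddCommGroup X] [AddCommGroup Y]

/-! ### The rational cocharacter space `V = ℚ ⊗ Y` of a root datum `(X, Φ, Y, Φ^∨)` -/

/-- The root datum is semisimple: the roots span a subgroup of finite index in the (finitely
generated) character group `X`, i.e. they span the rational vector space `ℚ ⊗ X`. -/
class IsSemisimple (P : RootDatum ι X Y) : Prop where
  exists_smul_mem : ∀ x : X, ∃ n : ℕ, n ≠ 0 ∧ n • x ∈ P.rootSpan ℤ

/-- The rational vector space `V = ℚ ⊗ Y`. -/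
abbrev V (Y : Type*) [AddCommGroup Y] : Type _ := ℚ ⊗[ℤ] Y

/-- The subgroup `Y` of `V = ℚ ⊗ Y`. -/
def lattice (Y : Type*) [AddCommGroup Y] : AddSubgroup (V Y) :=
  (TensorProduct.mk ℤ ℚ Y 1).toAddMonoidHom.range

/-- The pairing `⟨x, v⟩ ∈ ℚ` of a character `x ∈ X` with `v ∈ V`, i.e. the `ℚ`-linear extension
of the perfect pairing between `X` and `Y`. -/
def charEval (P : RootDatum ι X Y) (x : X) : V Y →ₗ[ℚ] ℚ :=
  LinearMap.liftBaseChange ℚ ((Algebra.linearMap ℤ ℚ).comp (P.toLinearMap x))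

/-- The pairing `⟨α, v⟩ ∈ ℚ` of a root with `v ∈ V`. -/
def rootEval (P : RootDatum ι X Y) (i : ι) : V Y →ₗ[ℚ] ℚ := charEval P (P.root i)

/-- The action of the Weyl group on `V`: `w` acts on `Y` by the inverse transpose of its action
on `X`, and on `V` by extension of scalars. -/
def weylRep (P : RootDatum ι X Y) : Representation ℚ P.weylGroup (V Y) where
  toFun w := ((w⁻¹ : P.weylGroup) : P.Aut).coweightMap.baseChange ℚ
  map_one' := by
    ext y
    simp [RootPairing.Equiv.toHom_one]
  map_mul' w w' := by
    have h : (((w * w')⁻¹ : P.weylGroup) : P.Aut).coweightMap =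
        ((w⁻¹ : P.weylGroup) : P.Aut).coweightMap ∘ₗ
          ((w'⁻¹ : P.weylGroup) : P.Aut).coweightMap := by
      rw [mul_inv_rev, Subgroup.coe_mul]
      rfl
    rw [h, LinearMap.baseChange_comp]
    rfl

/-! ### Fundamental coweights -/

theorem charEval_tmul (P : RootDatum ι X Y) (x : X) (q : ℚ) (y : Y) :
    charEval P x (q ⊗ₜ y) = q * (P.toLinearMap x y : ℚ) := by
  simp [charEval]

theorem charEval_add (P : RootDatum ι X Y) (x x' : X) (v : V Y) :
    charEval P (x + x') v = charEval P x v + charEval P x' v := by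
  induction v using TensorProduct.induction_on with
  | zero => simp
  | tmul q y => simp [charEval_tmul, mul_add]
  | add v w hv hw => simp only [map_add, hv, hw]; ring

/-- Evaluation at `v ∈ V`, as a homomorphism on characters. -/
def evalHom (P : RootDatum ι X Y) (v : V Y) : X →+ ℚ :=
  AddMonoidHom.mk' (fun x => charEval P x v) (fun x x' => charEval_add P x x' v)

theorem eq_zero_of_charEval [Module.Free ℤ Y] [Module.Finite ℤ Y] (P : RootDatum ι X Y) (v : V Y)
    (h : ∀ x, charEval P x v = 0) : v = 0 := by
  classical
  let B := Module.Free.chooseBasis ℤ Y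
  let BV := B.baseChange ℚ
  apply BV.repr.injective
  rw [map_zero]
  ext k
  obtain ⟨x, hx⟩ := P.toLinearMap.toPerfPair.surjective (B.coord k)
  have key : charEval P x = BV.coord k := by
    apply BV.ext
    intro j
    have hx' : P.toLinearMap x (B j) = B.coord k (B j) := by
      rw [← hx]; rfl
    simp only [BV, Module.Basis.baseChange_apply, charEval_tmul, hx']
    simp [Finsupp.single_apply]
  have := h x
  rw [key] at this
  simpa using this

theorem eq_zero_of_rootEval [Module.Free ℤ Y] [Module.Finite ℤ Y] (P : RootDatum ι X Y)
    [IsSemisimple P] (b : P.Base) (v : V Y)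
    (h : ∀ i ∈ b.support, rootEval P i v = 0) : v = 0 := by
  apply eq_zero_of_charEval P
  intro x
  obtain ⟨n, hn, hx⟩ := IsSemisimple.exists_smul_mem (P := P) x
  have hle : P.rootSpan ℤ ≤ LinearMap.ker (evalHom P v).toIntLinearMap := by
    have h1 : P.rootSpan ℤ = Submodule.span ℤ (P.root '' b.support) :=
      b.span_int_root_support.symm
    rw [h1, Submodule.span_le]
    rintro _ ⟨i, hi, rfl⟩
    exact h i hi
  have h0 : evalHom P v (n • x) = 0 := hle hx
  rw [map_nsmul, smul_eq_zero] at h0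
  exact h0.resolve_left hn

/-- The defining property of the family `(ϖ^∨_α)` of fundamental coweights, the basis of `V` dual
to the simple roots (extended by `0` to the roots that are not simple). -/
def IsFundamentalCoweights {P : RootDatum ι X Y} (b : P.Base) (ϖ : ι → V Y) : Prop :=
  (∀ i ∈ b.support, ∀ j ∈ b.support, (i = j → rootEval P j (ϖ i) = 1) ∧
    (i ≠ j → rootEval P j (ϖ i) = 0)) ∧
  ∀ i, i ∉ b.support → ϖ i = 0

theorem existsUnique_isFundamentalCoweights [Module.Free ℤ X] [Module.Finite ℤ X]
    [Module.Free ℤ Y] [Module.Finite ℤ Y] {P : RootDatum ι X Y} [IsSemisimple P] (b : P.Base) :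
    ∃! ϖ : ι → V Y, IsFundamentalCoweights b ϖ := by
  classical
  let T : V Y →ₗ[ℚ] (b.support → ℚ) := LinearMap.pi fun i => rootEval P i
  have hT : Function.Injective T := by
    rw [← LinearMap.ker_eq_bot, LinearMap.ker_eq_bot']
    intro v hv
    exact eq_zero_of_rootEval P b v fun i hi => congrFun hv ⟨i, hi⟩
  have hdim : Module.finrank ℚ (V Y) = Module.finrank ℚ (b.support → ℚ) := by
    apply le_antisymm (LinearMap.finrank_le_finrank_of_injective hT)
    rw [Module.finrank_fintype_fun_eq_card, Module.finrank_baseChange,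
      ← Module.finrank_of_isPerfPair P.toLinearMap]
    exact LinearIndependent.fintype_card_le_finrank (b := fun i : b.support => P.root i)
      b.linearIndepOn_root
  have hsurj : Function.Surjective T :=
    (LinearMap.injective_iff_surjective_of_finrank_eq_finrank hdim).mp hT
  choose f hf using fun i : b.support => hsurj (Pi.single i 1)
  refine ⟨fun i => if h : i ∈ b.support then f ⟨i, h⟩ else 0, ⟨?_, ?_⟩, ?_⟩
  · intro i hi j hj
    have := congrFun (hf ⟨i, hi⟩) ⟨j, hj⟩
    simp only [hi, dite_true]
    constructor
    · rintro rfl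
      simpa [T] using this
    · intro hij
      have hij' : (⟨j, hj⟩ : b.support) ≠ ⟨i, hi⟩ := fun h => hij (Subtype.ext_iff.mp h).symm
      simpa [T, hij'] using this
  · intro i hi
    simp [hi]
  · rintro ϖ ⟨h1, h2⟩
    funext i
    by_cases hi : i ∈ b.support
    · simp only [hi, dite_true]
      apply hT
      rw [hf]
      funext j
      by_cases hij : i = j
      · subst hij
        simpa [T] using (h1 _ hi _ hi).1 rfl
      · have hij' : j ≠ ⟨i, hi⟩ := fun h => hij (by rw [h])
        simpa [T, hij'] using (h1 i hi j j.2).2 hij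
    · simp [hi, h2 i hi]

/-- The fundamental coweights `ϖ^∨_α`. -/
def fundamentalCoweight [Module.Free ℤ X] [Module.Finite ℤ X] [Module.Free ℤ Y]
    [Module.Finite ℤ Y] {P : RootDatum ι X Y} [IsSemisimple P] (b : P.Base) : ι → V Y :=
  (existsUnique_isFundamentalCoweights b).choose

/-! ### Irreducible components, highest roots, the extended set of simple roots -/

/-- The irreducible components of `Φ`: the classes of roots for the equivalence relation generated
by non-orthogonality. -/
def Component (P : RootDatum ι X Y) : Type _ := Quot fun i j : ι => P.pairing i j ≠ 0

/-- The set `Φ_c` of roots of an irreducible component `c`. -/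
def Component.roots {P : RootDatum ι X Y} (c : Component P) : Set ι := {i | Quot.mk _ i = c}

theorem Component.exists_highest [Finite ι] {P : RootDatum ι X Y} (b : P.Base) (c : Component P) :
    ∃ i ∈ c.roots, ∀ j ∈ c.roots, b.height j ≤ b.height i := by
  have hne : c.roots.Nonempty := by
    obtain ⟨i, hi⟩ := Quot.exists_rep c
    exact ⟨i, hi⟩
  exact Set.exists_max_image _ _ (Set.toFinite _) hne

/-- The highest root `α̃_c` of the component `c`. -/
def highestRoot [Finite ι] {P : RootDatum ι X Y} (b : P.Base) (c : Component P) : ι :=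
  (c.exists_highest b).choose

/-- The negative `-α̃_c` of the highest root of the component `c`; note that the reflection
in a root sends this root to its negative. -/
def negHighestRoot [Finite ι] {P : RootDatum ι X Y} (b : P.Base) (c : Component P) : ι :=
  P.reflectionPerm (highestRoot b c) (highestRoot b c)

/-- The set `Δ_c = Δ ∩ Φ_c` of simple roots of the component `c`. -/
def simpleRoots {P : RootDatum ι X Y} (b : P.Base) (c : Component P) : Set ι :=
  {i | i ∈ b.support ∧ i ∈ c.roots}

/-- The set `Δ̃_c = Δ_c ∪ {-α̃_c}`. -/
def extSimpleRoots [Finite ι] {P : RootDatum ι X Y} (b : P.Base) (c : Component P) : Set ι :=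
  simpleRoots b c ∪ {negHighestRoot b c}

/-- The set `Δ̃`, the union of the sets `Δ̃_c`. -/
def extSimple [Finite ι] {P : RootDatum ι X Y} (b : P.Base) : Set ι :=
  ⋃ c, extSimpleRoots b c

open Classical in
/-- The integers `n_α`: for a simple root `α` of the component `c`, the coefficient of `α` in the
highest root `α̃_c`, and `1` for the other elements of `Δ̃`. -/
def mark [Finite ι] {P : RootDatum ι X Y} (b : P.Base) (i : ι) : ℤ :=
  if h : i ∈ b.support then
    b.toWeightBasisInt.repr (P.rootSpanMem ℤ (highestRoot b (Quot.mk _ i))) ⟨i, h⟩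
  else 1

open Classical in
/-- The integers `m_α` for `α ∈ Δ̃`: `0` for a simple root and `-1` for the `-α̃_c`. -/
def shift {P : RootDatum ι X Y} (b : P.Base) (i : ι) : ℤ :=
  if i ∈ b.support then 0 else -1

/-! ### The alcove and affine coordinates -/

/-- The fundamental alcove `{v ∈ V | ⟨α, v⟩ ≥ m_α for all α ∈ Δ̃}`. -/
def alcove [Finite ι] {P : RootDatum ι X Y} (b : P.Base) : Set (V Y) :=
  {v | ∀ i ∈ extSimple b, (shift b i : ℚ) ≤ rootEval P i v}

/-- `a = (a_α)`, a family of rational numbers indexed by `Δ̃` (extended by `0`), is the family of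
affine coordinates of `v`: the sum over each `Δ̃_c` is `1`, and `v = ∑ (a_α / n_α) ϖ^∨_α`. -/
def IsAffineCoord [Finite ι] [Module.Free ℤ X] [Module.Finite ℤ X] [Module.Free ℤ Y]
    [Module.Finite ℤ Y] {P : RootDatum ι X Y} [IsSemisimple P] (b : P.Base) (v : V Y)
    (a : ι → ℚ) : Prop :=
  (∀ i, i ∉ extSimple b → a i = 0) ∧
  (∀ c : Component P, ∑ᶠ i ∈ extSimpleRoots b c, a i = 1) ∧
  v = ∑ᶠ i ∈ extSimple b, (a i / (mark b i : ℚ)) • fundamentalCoweight b i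

/-- The affine coordinates `(v_α)` of `v`, the family characterized by `IsAffineCoord`. -/
def affineCoord [Finite ι] [Module.Free ℤ X] [Module.Finite ℤ X] [Module.Free ℤ Y]
    [Module.Finite ℤ Y] {P : RootDatum ι X Y} [IsSemisimple P] (b : P.Base) (v : V Y) : ι → ℚ :=
  Classical.epsilon (IsAffineCoord b v)

/-- `I_v = {α ∈ Δ̃ | v_α = 0}`. -/
def zeroSet [Finite ι] [Module.Free ℤ X] [Module.Finite ℤ X] [Module.Free ℤ Y]
    [Module.Finite ℤ Y] {P : RootDatum ι X Y} [IsSemisimple P] (b : P.Base) (v : V Y) : Set ι :=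
  {i ∈ extSimple b | affineCoord b v i = 0}

/-! ### The groups `W_G(v)`, `W°(v)`, isolated and quasi-isolated elements -/

/-- `Φ(v) = {α ∈ Φ | ⟨α, v⟩ ∈ ℤ}`. -/
def integralRoots (P : RootDatum ι X Y) (v : V Y) : Set ι :=
  {i | ∃ n : ℤ, rootEval P i v = n}

/-- The subgroup of the Weyl group generated by the reflections in the roots of `S`. -/
def reflectionSubgroup (P : RootDatum ι X Y) (S : Set ι) : Subgroup P.weylGroup :=
  Subgroup.closure (RootPairing.weylGroup.ofIdx P '' S)

theorem weylRep_mem_lattice (P : RootDatum ι X Y) (w : P.weylGroup) {v : V Y}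
    (hv : v ∈ lattice Y) : weylRep P w v ∈ lattice Y := by
  obtain ⟨y, rfl⟩ := hv
  exact ⟨((w⁻¹ : P.weylGroup) : P.Aut).coweightMap y, rfl⟩

/-- `W_G(v) = {w ∈ W | w(v) - v ∈ Y}`. -/
def weylStabilizer (P : RootDatum ι X Y) (v : V Y) : Subgroup P.weylGroup where
  carrier := {w | weylRep P w v - v ∈ lattice Y}
  one_mem' := by simp [zero_mem]
  mul_mem' {w w'} hw hw' := by
    have h := (lattice Y).add_mem (weylRep_mem_lattice P w hw') hw
    simpa [map_mul] using h
  inv_mem' {w} hw := by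
    have h := (lattice Y).neg_mem (weylRep_mem_lattice P w⁻¹ hw)
    have h' : weylRep P w⁻¹ (weylRep P w v) = v := by
      rw [← Module.End.mul_apply, ← map_mul, inv_mul_cancel, map_one, Module.End.one_apply]
    rw [map_sub, h', neg_sub] at h
    exact h

/-- `W°(v)`, the Weyl group of the root system `Φ(v)`. -/
def weylStabilizerZero (P : RootDatum ι X Y) (v : V Y) : Subgroup P.weylGroup :=
  reflectionSubgroup P (integralRoots P v)

/-- Parabolic subgroups of `W`: the conjugates of the subgroups generated by simple reflections. -/
def IsParabolic {P : RootDatum ι X Y} (b : P.Base) (H : Subgroup P.weylGroup) : Prop :=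
  ∃ I : Set ι, I ⊆ b.support ∧ ∃ w : P.weylGroup,
    H = (reflectionSubgroup P I).map (MulAut.conj w).toMonoidHom

/-- `v` is `G`-isolated: `W°(v)` is not contained in a proper parabolic subgroup of `W`. -/
def IsIsolated {P : RootDatum ι X Y} (b : P.Base) (v : V Y) : Prop :=
  ¬ ∃ H : Subgroup P.weylGroup, IsParabolic b H ∧ H ≠ ⊤ ∧ weylStabilizerZero P v ≤ H

/-- `v` is `G`-quasi-isolated: `W_G(v)` is not contained in a proper parabolic subgroup of `W`. -/
def IsQuasiIsolated {P : RootDatum ι X Y} (b : P.Base) (v : V Y) : Prop :=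
  ¬ ∃ H : Subgroup P.weylGroup, IsParabolic b H ∧ H ≠ ⊤ ∧ weylStabilizer P v ≤ H

/-- `I` is a basis of the root system `S ⊆ Φ`: it is a linearly independent subset of `S` and every
root of `S` is a combination of elements of `I` with integral coefficients of the same sign. -/
def IsRootBasis (P : RootDatum ι X Y) (I S : Set ι) : Prop :=
  I ⊆ S ∧ LinearIndepOn ℤ P.root I ∧
  ∀ i ∈ S, P.root i ∈ AddSubmonoid.closure (P.root '' I) ∨
    -P.root i ∈ AddSubmonoid.closure (P.root '' I)

/-- The positive system `Φ⁺(v)` of `Φ(v)` associated with `I_v`. -/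
def positiveIntegralRoots [Finite ι] [Module.Free ℤ X] [Module.Finite ℤ X] [Module.Free ℤ Y]
    [Module.Finite ℤ Y] {P : RootDatum ι X Y} [IsSemisimple P] (b : P.Base) (v : V Y) : Set ι :=
  {i ∈ integralRoots P v | P.root i ∈ AddSubmonoid.closure (P.root '' zeroSet b v)}

/-- `A_G(v) = {w ∈ W_G(v) | w(Φ⁺(v)) = Φ⁺(v)}`. -/
def componentStabilizer [Finite ι] [Module.Free ℤ X] [Module.Finite ℤ X] [Module.Free ℤ Y]
    [Module.Finite ℤ Y] {P : RootDatum ι X Y} [IsSemisimple P] (b : P.Base) (v : V Y) :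
    Subgroup P.weylGroup :=
  weylStabilizer P v ⊓ MulAction.stabilizer P.weylGroup (positiveIntegralRoots b v)

/-! ### The groups `𝒜` and `𝒜_G` -/

/-- `𝒜 = {z ∈ W | z(Δ̃) = Δ̃}`. -/
def diagramGroup [Finite ι] {P : RootDatum ι X Y} (b : P.Base) : Subgroup P.weylGroup :=
  MulAction.stabilizer P.weylGroup (extSimple b)

/-- `Δ̃_{c,min} = {α ∈ Δ̃_c | n_α = 1}`. -/
def minusculeRoots [Finite ι] {P : RootDatum ι X Y} (b : P.Base) (c : Component P) : Set ι :=
  {i ∈ extSimpleRoots b c | mark b i = 1}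

/-- For `α ∈ Δ̃_c`, the parabolic subsystem `Φ_α` of `Φ_c` with basis `Δ_c - {α}`; in particular
`Φ_α = Φ_c` for `α = -α̃_c`. -/
def parabolicRoots {P : RootDatum ι X Y} (b : P.Base) (c : Component P) (i : ι) : Set ι :=
  {j | P.root j ∈ Submodule.span ℤ (P.root '' (simpleRoots b c \ {i}))}

/-- `w` is the element `w_α` of the Weyl group `W_α` of `Φ_α` such that `w(Φ_α⁺) = -Φ_α⁺`. -/
def IsLongest {P : RootDatum ι X Y} (b : P.Base) (c : Component P) (i : ι) (w : P.weylGroup) :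
    Prop :=
  w ∈ reflectionSubgroup P (parabolicRoots b c i) ∧
  w • {j ∈ parabolicRoots b c i | b.IsPos j} = {j ∈ parabolicRoots b c i | ¬ b.IsPos j}

/-- The component in `W_c` of `z ∈ W = ∏ W_c` is `z_α = w_α w_{-α̃_c}`; this means that `z` acts on
`Φ_c` as the element `z_α` of `W_c`. -/
def HasComponent [Finite ι] {P : RootDatum ι X Y} (b : P.Base) (c : Component P) (i : ι)
    (z : P.weylGroup) : Prop :=
  ∃ w w₀ : P.weylGroup, IsLongest b c i w ∧ IsLongest b c (negHighestRoot b c) w₀ ∧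
    ∀ j ∈ c.roots, z • j = (w * w₀) • j

/-- `𝒜_G`, the set of the `z = (z_{α_c})_c` in `𝒜`, with `α_c ∈ Δ̃_{c,min}`, such that
`ϖ^∨(z) = ∑ ϖ^∨_{α_c}` lies in `Y`; it is the inverse image of `Y / ⟨Φ^∨⟩` under the isomorphism
from `𝒜` to the quotient by `⟨Φ^∨⟩` of the coweight lattice that is given by `ϖ^∨`. -/
def diagramGroupOf [Finite ι] [Module.Free ℤ X] [Module.Finite ℤ X] [Module.Free ℤ Y]
    [Module.Finite ℤ Y] {P : RootDatum ι X Y} [IsSemisimple P] (b : P.Base) :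
    Set P.weylGroup :=
  {z | z ∈ diagramGroup b ∧ ∃ α : Component P → ι,
    (∀ c, α c ∈ minusculeRoots b c ∧ HasComponent b c (α c) z) ∧
    ∑ᶠ c, fundamentalCoweight b (α c) ∈ lattice Y}

end QuasiIsolated

end

/-!
Everything is expressed through the pairing of roots with vectors of `V`. The coefficient of a
simple root `j` in a root `i` is `⟨i, ϖ^∨_j⟩`, and the highest root of a component dominates all
the roots of that component coefficientwise (`coef_le_coef_highestRoot`). Hence the relation
`∑ n_α α = 0` over `Δ̃_c` has positive coefficients; it is, up to scaling, the only linear relation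
between elements of `Δ̃_c`. The affine coordinates of `v` are therefore the numbers
`n_α (⟨α, v⟩ - m_α)`, and every set missing an element of each `Δ̃_c` is linearly independent. On
the alcove all roots take values in `[-1, 1]`, so that a positive root which is integral at `v`
takes the value `0` or `1` there. In the first case it is a sum of simple roots vanishing at `v`,
in the second case its difference to the highest root is such a sum. This proves that `I_v` is a
basis of `Φ(v)`.

For the description of `A_G(v)`, let the level of a root be its integer part on the interior of
the alcove. The elements of `Δ̃` are the roots that are indecomposable compatibly with levels
(`mem_extSimple_iff_indecomposable`). An element `w` of `A_G(v)` satisfies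
`⟨w α, v⟩ - level (w α) = ⟨α, v⟩ - level α` for all roots (`rootEval_sub_level_smul`), since both
sides lie in `[0, 1]`, differ by an integer, and are equal to `0` or `1` simultaneously. Hence `w`
preserves `Δ̃`, the marks and the affine coordinates of `v`. Conversely, an element `z` of `𝒜`
acts on `Φ_c` as `z_α` with `α = z(-α̃_c)` (`hasComponent_of_mem_diagramGroup`), and if it preserves
the affine coordinates of `v`, then `z v - v = -ϖ^∨(z)` (`weylRep_sub_eq`).

For the last two criteria, a subgroup of `W` lies in a proper parabolic subgroup if and only if it
fixes a nonzero vector (`exists_isParabolic_iff`); this rests on the exchange condition. The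
vectors fixed by `W°(v)` are those orthogonal to `I_v`, and `W_G(v)` is generated by `W°(v)` and
`A_G(v)`. A vector orthogonal to `I_v` is a family of values on the sets `Δ̃_c \ I_v` subject to
the relation with positive coefficients `n_α`, so a nonzero one that is fixed by a group of
permutations of `Δ̃` exists exactly when this group is not transitive on some `Δ̃_c \ I_v`
(`forall_eq_zero_iff_transitive`). The criteria are the cases of the trivial group and of
`A_G(v)`.
-/

noncomputable section

namespace QuasiIsolated

/-! ### Roots, coroots and the Weyl group acting on `V` -/

section Basic

variable {ι X Y : Type*} [AddCommGroup X] [AddCommGroup Y] (P : RootDatum ι X Y)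

theorem evalHom_root (v : V Y) (i : ι) : evalHom P v (P.root i) = rootEval P i v := rfl

theorem rootEval_neg (i : ι) (v : V Y) :
    rootEval P (P.reflectionPerm i i) v = -rootEval P i v := by
  rw [← evalHom_root, ← evalHom_root, RootPairing.root_reflectionPerm,
    RootPairing.reflection_apply_self, map_neg]

theorem rootEval_coroot (i j : ι) :
    rootEval P i ((1 : ℚ) ⊗ₜ P.coroot j) = P.pairing i j := by
  simp [rootEval, charEval_tmul]

theorem coroot_mem_lattice (j : ι) : (1 : ℚ) ⊗ₜ[ℤ] P.coroot j ∈ lattice Y :=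
  ⟨P.coroot j, rfl⟩

/-- Elements of `Y` take integral values on roots. -/
theorem exists_int_of_mem_lattice {y : V Y} (hy : y ∈ lattice Y) (i : ι) :
    ∃ n : ℤ, rootEval P i y = n := by
  obtain ⟨y, rfl⟩ := hy
  refine ⟨P.toLinearMap (P.root i) y, ?_⟩
  change rootEval P i ((1 : ℚ) ⊗ₜ[ℤ] y) = _
  simp [rootEval, charEval_tmul]

variable {P}

theorem root_smul (w : P.weylGroup) (i : ι) : P.root (w • i) = w • P.root i :=
  RootPairing.Equiv.root_indexEquiv_eq_smul P i (w : P.Aut)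

theorem ofIdx_smul_eq (i j : ι) :
    RootPairing.weylGroup.ofIdx P i • j = P.reflectionPerm i j := rfl

theorem ofIdx_mul_self (i : ι) :
    RootPairing.weylGroup.ofIdx P i * RootPairing.weylGroup.ofIdx P i = 1 := by
  apply Subtype.ext
  have := RootPairing.Equiv.reflection_inv P i
  change RootPairing.Equiv.reflection P i * RootPairing.Equiv.reflection P i = 1
  nth_rewrite 1 [← this]
  exact inv_mul_cancel _

theorem smul_neg_idx (w : P.weylGroup) (i : ι) :
    w • P.reflectionPerm i i = P.reflectionPerm (w • i) (w • i) := by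
  apply P.root.injective
  rw [root_smul, RootPairing.root_reflectionPerm, RootPairing.reflection_apply_self,
    RootPairing.root_reflectionPerm, RootPairing.reflection_apply_self, smul_neg, root_smul]

/-- The pairing between `X` and `V` is invariant under the Weyl group. -/
theorem rootEval_smul_weylRep (w : P.weylGroup) (i : ι) (v : V Y) :
    rootEval P (w • i) (weylRep P w v) = rootEval P i v := by
  induction v using TensorProduct.induction_on with
  | zero => simp
  | add x y hx hy => simp only [map_add, hx, hy]
  | tmul q y =>
    have h1 : weylRep P w (q ⊗ₜ[ℤ] y) =
        q ⊗ₜ[ℤ] (((w⁻¹ : P.weylGroup) : P.Aut).coweightMap y) := rfl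
    have h2 := RootPairing.Hom.weight_coweight_transpose_apply P P y
      ((w⁻¹ : P.weylGroup) : P.Aut).toHom
    have h3 : P.toLinearMap (((w⁻¹ : P.weylGroup) : P.Aut).weightMap (P.root (w • i))) y =
        P.toLinearMap (P.root (w • i)) (((w⁻¹ : P.weylGroup) : P.Aut).coweightMap y) :=
      DFunLike.congr_fun h2 (P.root (w • i))
    have h4 : ((w⁻¹ : P.weylGroup) : P.Aut).weightMap (P.root (w • i)) = P.root i := by
      have : (w⁻¹ : P.weylGroup) • P.root (w • i) = P.root i := by
        rw [← root_smul, inv_smul_smul]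
      exact this
    rw [h1, rootEval, rootEval, charEval_tmul, charEval_tmul, ← h3, h4]

theorem rootEval_weylRep (w : P.weylGroup) (i : ι) (v : V Y) :
    rootEval P i (weylRep P w v) = rootEval P (w⁻¹ • i) v := by
  rw [← rootEval_smul_weylRep w (w⁻¹ • i), smul_inv_smul]

theorem weylRep_mul_apply (w w' : P.weylGroup) (v : V Y) :
    weylRep P (w * w') v = weylRep P w (weylRep P w' v) := by
  rw [map_mul, Module.End.mul_apply]

theorem weylRep_inv_apply (w : P.weylGroup) (v : V Y) :
    weylRep P w⁻¹ (weylRep P w v) = v := by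
  rw [← weylRep_mul_apply, inv_mul_cancel, map_one, Module.End.one_apply]

theorem ofIdx_inv (i : ι) :
    (RootPairing.weylGroup.ofIdx P i)⁻¹ = RootPairing.weylGroup.ofIdx P i :=
  inv_eq_of_mul_eq_one_left (ofIdx_mul_self i)

theorem weylRep_ofIdx (i : ι) (v : V Y) :
    weylRep P (RootPairing.weylGroup.ofIdx P i) v =
      v - rootEval P i v • ((1 : ℚ) ⊗ₜ[ℤ] P.coroot i) := by
  induction v using TensorProduct.induction_on with
  | zero => simp
  | add x y hx hy => simp only [map_add, hx, hy, add_smul]; abel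
  | tmul q y =>
    have h1 : weylRep P (RootPairing.weylGroup.ofIdx P i) (q ⊗ₜ[ℤ] y) =
        q ⊗ₜ[ℤ] (((RootPairing.weylGroup.ofIdx P i)⁻¹ : P.weylGroup) : P.Aut).coweightMap y := rfl
    rw [h1, ofIdx_inv]
    have h2 : ((RootPairing.weylGroup.ofIdx P i : P.weylGroup) : P.Aut).coweightMap y =
        y - P.toLinearMap (P.root i) y • P.coroot i := rfl
    rw [h2, TensorProduct.tmul_sub, rootEval, charEval_tmul, TensorProduct.tmul_smul,
      TensorProduct.smul_tmul', TensorProduct.smul_tmul']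
    simp [mul_comm]

theorem weylRep_ofIdx_eq_self_iff (i : ι) (v : V Y) :
    weylRep P (RootPairing.weylGroup.ofIdx P i) v = v ↔ rootEval P i v = 0 := by
  rw [weylRep_ofIdx]
  constructor
  · intro h
    have := congrArg (rootEval P i) h
    rw [map_sub, map_smul, rootEval_coroot, RootPairing.pairing_same] at this
    simp at this
    linarith
  · intro h
    simp [h]

end Basic

/-! ### Coefficients of roots with respect to the simple roots -/

section Coefficients

variable {ι X Y : Type*} [AddCommGroup X] [AddCommGroup Y] {P : RootDatum ι X Y} (b : P.Base)

open Classical in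
/-- The coefficient of the simple root `j` in the root `i` (`0` if `j` is not simple). -/
def coef (j i : ι) : ℤ :=
  if h : j ∈ b.support then b.toWeightBasisInt.repr (P.rootSpanMem ℤ i) ⟨j, h⟩ else 0

theorem coef_of_notMem {j : ι} (hj : j ∉ b.support) (i : ι) : coef b j i = 0 := by
  simp [coef, hj]

theorem root_eq_sum_coef (i : ι) : P.root i = ∑ j ∈ b.support, coef b j i • P.root j := by
  have h := congrArg (Subtype.val) (b.toWeightBasisInt.sum_repr (P.rootSpanMem ℤ i))
  rw [← Finset.sum_coe_sort]
  simp only [AddSubmonoidClass.coe_finsetSum, Submodule.coe_smul,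
    RootPairing.Base.coe_toWeightBasisInt_apply] at h
  change P.root i = _
  rw [← h]
  refine Finset.sum_congr rfl fun j _ => ?_
  simp [coef]

theorem linearIndep_simple {f g : ι → ℤ}
    (h : ∑ j ∈ b.support, f j • P.root j = ∑ j ∈ b.support, g j • P.root j) {j : ι}
    (hj : j ∈ b.support) : f j = g j := by
  have hl := b.linearIndepOn_root
  have h0 : ∑ j ∈ b.support, (f j - g j) • P.root j = 0 := by
    simp only [sub_smul, Finset.sum_sub_distrib, h, sub_self]
  have := linearIndepOn_iff'.mp hl b.support (fun j => f j - g j) (by simp) h0 j hj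
  linarith

theorem coef_eq_of_root_eq {i : ι} {f : ι → ℤ}
    (h : P.root i = ∑ j ∈ b.support, f j • P.root j) {j : ι} (hj : j ∈ b.support) :
    coef b j i = f j :=
  linearIndep_simple b ((root_eq_sum_coef b i).symm.trans h) hj

theorem coef_add {i j k : ι} (h : P.root k = P.root i + P.root j) (l : ι) :
    coef b l k = coef b l i + coef b l j := by
  by_cases hl : l ∈ b.support
  · refine coef_eq_of_root_eq b (f := fun l => coef b l i + coef b l j) ?_ hl
    simp only [add_smul, Finset.sum_add_distrib, ← root_eq_sum_coef, h]
  · simp [coef_of_notMem b hl]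

theorem coef_neg (i l : ι) : coef b l (P.reflectionPerm i i) = -coef b l i := by
  by_cases hl : l ∈ b.support
  · refine coef_eq_of_root_eq b (f := fun l => -coef b l i) ?_ hl
    simp only [neg_smul, Finset.sum_neg_distrib, ← root_eq_sum_coef]
    simp
  · simp [coef_of_notMem b hl]

theorem coef_sub_smul {i j k : ι} {n : ℤ} (h : P.root k = P.root i - n • P.root j) (l : ι) :
    coef b l k = coef b l i - n * coef b l j := by
  by_cases hl : l ∈ b.support
  · refine coef_eq_of_root_eq b (f := fun l => coef b l i - n * coef b l j) ?_ hl
    simp only [sub_smul, Finset.sum_sub_distrib, ← root_eq_sum_coef, mul_smul, ← Finset.smul_sum, h]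
  · simp [coef_of_notMem b hl]

theorem coef_reflectionPerm (i j l : ι) :
    coef b l (P.reflectionPerm j i) = coef b l i - P.pairing i j * coef b l j := by
  apply coef_sub_smul
  rw [RootPairing.root_reflectionPerm, RootPairing.reflection_apply_root]

theorem coef_simple_self {j : ι} (hj : j ∈ b.support) : coef b j j = 1 := by
  classical
  have := coef_eq_of_root_eq b (i := j) (f := fun l => if l = j then 1 else 0)
    (by simp [ite_smul, hj]) hj
  simpa using this

theorem coef_simple_of_ne {i j : ι} (hi : i ∈ b.support) (hij : j ≠ i) : coef b j i = 0 := by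
  classical
  by_cases hj : j ∈ b.support
  · have := coef_eq_of_root_eq b (i := i) (f := fun l => if l = i then 1 else 0)
      (by simp [ite_smul, hi]) hj
    simpa [hij] using this
  · exact coef_of_notMem b hj i

theorem height_eq_sum_coef (i : ι) : b.height i = ∑ j ∈ b.support, coef b j i :=
  RootPairing.Base.height_eq_sum (root_eq_sum_coef b i)

theorem coef_nonneg_or_nonpos (i : ι) : (∀ j, 0 ≤ coef b j i) ∨ (∀ j, coef b j i ≤ 0) := by
  obtain ⟨f, hf, hf' | hf'⟩ := b.exists_root_eq_sum_nat_or_neg i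
  · left
    intro j
    by_cases hj : j ∈ b.support
    · rw [coef_eq_of_root_eq b (f := fun j => (f j : ℤ)) (by simpa using hf') hj]
      positivity
    · rw [coef_of_notMem b hj]
  · right
    intro j
    by_cases hj : j ∈ b.support
    · rw [coef_eq_of_root_eq b (f := fun j => -(f j : ℤ)) (by simpa using hf') hj]
      simp
    · rw [coef_of_notMem b hj]

theorem isPos_iff_coef (i : ι) : b.IsPos i ↔ ∀ j, 0 ≤ coef b j i := by
  constructor
  · intro h
    rcases coef_nonneg_or_nonpos b i with h' | h'
    · exact h'
    · rw [RootPairing.Base.isPos_iff, height_eq_sum_coef] at h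
      exact absurd (Finset.sum_nonpos fun j _ => h' j) (not_le.mpr h)
  · intro h
    rw [RootPairing.Base.isPos_iff', height_eq_sum_coef]
    exact Finset.sum_nonneg fun j _ => h j

theorem not_isPos_iff_coef (i : ι) : ¬ b.IsPos i ↔ ∀ j, coef b j i ≤ 0 := by
  constructor
  · intro h
    rcases coef_nonneg_or_nonpos b i with h' | h'
    · exact absurd ((isPos_iff_coef b i).mpr h') h
    · exact h'
  · intro h hp
    rw [RootPairing.Base.isPos_iff, height_eq_sum_coef] at hp
    exact absurd (Finset.sum_nonpos fun j _ => h j) (not_le.mpr hp)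

theorem isPos_of_coef_pos {i j : ι} (h : 0 < coef b j i) : b.IsPos i := by
  by_contra hn
  exact absurd ((not_isPos_iff_coef b i).mp hn j) (not_le.mpr h)

theorem not_isPos_of_coef_neg {i j : ι} (h : coef b j i < 0) : ¬ b.IsPos i := fun hp =>
  absurd ((isPos_iff_coef b i).mp hp j) (not_le.mpr h)

theorem isPos_neg_iff (i : ι) : b.IsPos (P.reflectionPerm i i) ↔ ¬ b.IsPos i :=
  RootPairing.Base.IsPos.neg_iff_not b i

theorem exists_coef_ne_zero (i : ι) : ∃ j ∈ b.support, coef b j i ≠ 0 := by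
  by_contra! h
  apply P.ne_zero i
  rw [root_eq_sum_coef b i]
  exact Finset.sum_eq_zero fun j hj => by rw [h j hj, zero_smul]

theorem rootEval_eq_sum_coef (i : ι) (v : V Y) :
    rootEval P i v = ∑ j ∈ b.support, (coef b j i : ℚ) * rootEval P j v := by
  rw [← evalHom_root, root_eq_sum_coef b i, map_sum]
  refine Finset.sum_congr rfl fun j _ => ?_
  rw [map_zsmul, evalHom_root, zsmul_eq_mul]

theorem rootEval_eq_height_mul {v : V Y} {q : ℚ} (h : ∀ j ∈ b.support, rootEval P j v = q)
    (i : ι) : rootEval P i v = b.height i * q := by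
  rw [rootEval_eq_sum_coef b, height_eq_sum_coef, Int.cast_sum, Finset.sum_mul]
  exact Finset.sum_congr rfl fun j hj => by rw [h j hj]

theorem pairing_eq_sum_coef (i k : ι) :
    P.pairing i k = ∑ j ∈ b.support, coef b j i * P.pairing j k := by
  have h := rootEval_eq_sum_coef b i ((1 : ℚ) ⊗ₜ[ℤ] P.coroot k)
  simp only [rootEval_coroot] at h
  exact_mod_cast h

/-- A root is the sum of `coef` copies of each simple root, and its Weyl translates likewise. -/
theorem root_smul_eq_sum_coef (w : P.weylGroup) (i : ι) :
    P.root (w • i) = ∑ j ∈ b.support, coef b j i • P.root (w • j) := by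
  rw [root_smul, root_eq_sum_coef b i, Finset.smul_sum]
  exact Finset.sum_congr rfl fun j _ => by rw [smul_comm, root_smul]

theorem coef_smul_eq_sum (w : P.weylGroup) (i l : ι) :
    coef b l (w • i) = ∑ j ∈ b.support, coef b j i * coef b l (w • j) := by
  by_cases hl : l ∈ b.support
  · refine coef_eq_of_root_eq b (f := fun l => ∑ j ∈ b.support, coef b j i * coef b l (w • j)) ?_ hl
    rw [root_smul_eq_sum_coef b w i]
    simp only [Finset.sum_smul, mul_smul]
    rw [Finset.sum_comm]
    simp only [← Finset.smul_sum, ← root_eq_sum_coef]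
  · simp [coef_of_notMem b hl]

/-- A Weyl group element that makes the simple roots in the support of a positive root positive
makes this root positive. -/
theorem isPos_smul_of_forall {w : P.weylGroup} {i : ι} (hi : b.IsPos i)
    (h : ∀ j ∈ b.support, coef b j i ≠ 0 → b.IsPos (w • j)) : b.IsPos (w • i) := by
  rw [isPos_iff_coef]
  intro l
  rw [coef_smul_eq_sum b w i l]
  refine Finset.sum_nonneg fun j hj => ?_
  by_cases h0 : coef b j i = 0
  · simp [h0]
  · exact mul_nonneg ((isPos_iff_coef b i).mp hi j) ((isPos_iff_coef b _).mp (h j hj h0) l)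

theorem not_isPos_smul_of_forall {w : P.weylGroup} {i : ι} (hi : b.IsPos i)
    (h : ∀ j ∈ b.support, coef b j i ≠ 0 → ¬ b.IsPos (w • j)) : ¬ b.IsPos (w • i) := by
  rw [not_isPos_iff_coef]
  intro l
  rw [coef_smul_eq_sum b w i l]
  refine Finset.sum_nonpos fun j hj => ?_
  by_cases h0 : coef b j i = 0
  · simp [h0]
  · exact mul_nonpos_of_nonneg_of_nonpos ((isPos_iff_coef b i).mp hi j)
      ((not_isPos_iff_coef b _).mp (h j hj h0) l)

end Coefficients

section Coweights

variable {ι X Y : Type*} [AddCommGroup X] [AddCommGroup Y]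
  [Module.Free ℤ X] [Module.Finite ℤ X] [Module.Free ℤ Y] [Module.Finite ℤ Y]
  {P : RootDatum ι X Y} [IsSemisimple P] (b : P.Base)

theorem fundamentalCoweight_spec : IsFundamentalCoweights b (fundamentalCoweight b) :=
  (existsUnique_isFundamentalCoweights b).choose_spec.1

theorem fundamentalCoweight_of_notMem {j : ι} (hj : j ∉ b.support) :
    fundamentalCoweight b j = 0 :=
  (fundamentalCoweight_spec b).2 j hj

/-- Evaluation at the fundamental coweight of `j` reads off the coefficient of `j`. -/
theorem rootEval_fundamentalCoweight (i j : ι) :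
    rootEval P i (fundamentalCoweight b j) = coef b j i := by
  by_cases hj : j ∈ b.support
  · rw [rootEval_eq_sum_coef b i, Finset.sum_eq_single_of_mem j hj]
    · rw [((fundamentalCoweight_spec b).1 j hj j hj).1 rfl, mul_one]
    · intro k hk hkj
      rw [((fundamentalCoweight_spec b).1 j hj k hk).2 hkj.symm, mul_zero]
  · rw [fundamentalCoweight_of_notMem b hj, map_zero, coef_of_notMem b hj, Int.cast_zero]

omit [Module.Free ℤ X] [Module.Finite ℤ X] in
theorem ext_rootEval {v w : V Y} (h : ∀ i ∈ b.support, rootEval P i v = rootEval P i w) :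
    v = w := by
  rw [← sub_eq_zero]
  exact eq_zero_of_rootEval P b _ fun i hi => by rw [map_sub, h i hi, sub_self]

theorem exists_rootEval_eq (f : ι → ℚ) : ∃ v : V Y, ∀ i ∈ b.support, rootEval P i v = f i := by
  refine ⟨∑ j ∈ b.support, f j • fundamentalCoweight b j, fun i hi => ?_⟩
  simp only [map_sum, map_smul, rootEval_fundamentalCoweight, smul_eq_mul]
  rw [Finset.sum_eq_single_of_mem i hi]
  · rw [coef_simple_self b hi]; simp
  · intro k _ hk
    rw [coef_simple_of_ne b hi hk]; simp

end Coweights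

/-! ### Irreducible components and highest roots -/

section Components

variable {ι X Y : Type*} [AddCommGroup X] [AddCommGroup Y] {P : RootDatum ι X Y}

variable (P) in
/-- The irreducible component of a root. -/
def comp (i : ι) : Component P := Quot.mk _ i

theorem comp_eq_of_pairing_ne_zero {i j : ι} (h : P.pairing i j ≠ 0) : comp P i = comp P j :=
  Quot.sound h

theorem pairing_eq_zero_comm {i j : ι} : P.pairing i j = 0 ↔ P.pairing j i = 0 :=
  P.pairing_eq_zero_iff'

theorem comp_neg (i : ι) : comp P (P.reflectionPerm i i) = comp P i :=
  comp_eq_of_pairing_ne_zero (by simp)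

theorem comp_reflectionPerm (i j : ι) : comp P (P.reflectionPerm i j) = comp P j := by
  by_cases h : P.pairing j i = 0
  · rw [P.reflectionPerm_eq_of_pairing_eq_zero h]
  · rw [comp_eq_of_pairing_ne_zero h]
    apply comp_eq_of_pairing_ne_zero
    rw [← P.pairing_reflectionPerm, RootPairing.pairing_reflectionPerm_self_right]
    exact neg_ne_zero.mpr h

/-- The Weyl group preserves every irreducible component. -/
theorem comp_smul (w : P.weylGroup) (i : ι) : comp P (w • i) = comp P i := by
  obtain ⟨w, hw⟩ := w
  induction hw using RootPairing.weylGroup.induction generalizing i with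
  | mem j => exact comp_reflectionPerm j i
  | one => exact congrArg (comp P) (one_smul _ i)
  | mul x y hx hy ihx ihy =>
    have : (⟨x * y, mul_mem hx hy⟩ : P.weylGroup) • i =
      (⟨x, hx⟩ : P.weylGroup) • (⟨y, hy⟩ : P.weylGroup) • i := mul_smul x y i
    rw [this, ihx, ihy]

theorem comp_eq_of_root_eq_add {i j k : ι} (h : P.root k = P.root i + P.root j) :
    comp P k = comp P i ∧ comp P j = comp P i := by
  have h1 := P.pairing_eq_add_of_root_eq_add (l := i) h
  have h2 := P.pairing_eq_add_of_root_eq_add (l := j) h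
  have h3 := P.pairing_eq_add_of_root_eq_add (l := k) h
  rw [RootPairing.pairing_same] at h1 h2 h3
  by_cases hij : P.pairing i j = 0
  · have hji := pairing_eq_zero_comm.mp hij
    have hki : comp P k = comp P i := comp_eq_of_pairing_ne_zero (by rw [h1, hji]; norm_num)
    have hkj : comp P k = comp P j := comp_eq_of_pairing_ne_zero (by rw [h2, hij]; norm_num)
    exact ⟨hki, hkj ▸ hki⟩
  · have hij' := comp_eq_of_pairing_ne_zero hij
    refine ⟨?_, hij'.symm⟩
    by_contra hne
    have h4 : P.pairing i k = 0 := by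
      by_contra h
      exact hne (comp_eq_of_pairing_ne_zero h).symm
    have h5 : P.pairing j k = 0 := by
      by_contra h
      exact hne ((comp_eq_of_pairing_ne_zero h).symm.trans hij'.symm)
    rw [h4, h5] at h3
    norm_num at h3

variable [Finite ι]

omit [Finite ι] in
theorem pairingIn_int_eq (i j : ι) : P.pairingIn ℤ i j = P.pairing i j :=
  P.algebraMap_pairingIn ℤ i j

theorem pairing_pos_comm {i j : ι} : 0 < P.pairing i j ↔ 0 < P.pairing j i := by
  simpa [pairingIn_int_eq] using P.zero_lt_pairingIn_iff' ℤ (i := i) (j := j)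

theorem exists_root_eq_sub {i j : ι} (h : 0 < P.pairing i j) (hij : i ≠ j) :
    ∃ k, P.root k = P.root i - P.root j :=
  P.root_sub_root_mem_of_pairingIn_pos (i := i) (j := j) (by rwa [pairingIn_int_eq]) hij

theorem exists_root_eq_add {i j : ι} (h : P.pairing i j < 0) (hij : P.root i ≠ -P.root j) :
    ∃ k, P.root k = P.root i + P.root j :=
  P.root_add_root_mem_of_pairingIn_neg (i := i) (j := j) (by rwa [pairingIn_int_eq]) hij

variable (b : P.Base)

theorem comp_eq_of_coef_ne_zero {i j : ι} (h : coef b j i ≠ 0) : comp P j = comp P i := by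
  have key : ∀ i, b.IsPos i → ∀ j, coef b j i ≠ 0 → comp P j = comp P i := by
    intro i hi
    refine hi.induction_on_add (p := fun i => ∀ j, coef b j i ≠ 0 → comp P j = comp P i) ?_ ?_
    · intro i hi j hj
      by_cases hij : j = i
      · rw [hij]
      · exact absurd (coef_simple_of_ne b hi hij) hj
    · intro i j k hk ih hj l hl
      obtain ⟨h1, h2⟩ := comp_eq_of_root_eq_add hk
      rw [coef_add b hk] at hl
      by_cases hl' : coef b l i = 0
      · by_cases hlj : l = j
        · rw [hlj, h1, h2]
        · rw [hl', coef_simple_of_ne b hj hlj] at hl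
          exact absurd rfl hl
      · rw [ih l hl', h1]
  by_cases hi : b.IsPos i
  · exact key i hi j h
  · rw [← isPos_neg_iff] at hi
    rw [← comp_neg i]
    exact key _ hi j (by rwa [coef_neg, neg_ne_zero])

theorem coef_eq_zero_of_comp_ne {i j : ι} (h : comp P j ≠ comp P i) : coef b j i = 0 := by
  by_contra h'
  exact h (comp_eq_of_coef_ne_zero b h')

theorem pairing_nonpos_of_simple {i j : ι} (hi : i ∈ b.support) (hj : j ∈ b.support)
    (hij : i ≠ j) : P.pairing i j ≤ 0 := by
  rw [← pairingIn_int_eq]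
  exact b.pairingIn_le_zero_of_ne hij hi hj

/-- If `J` is a set of simple roots orthogonal to the other simple roots, then every root is
supported either on `J` or off `J`. -/
theorem coef_eq_zero_of_separated {J : Set ι}
    (hJ : ∀ j ∈ b.support, ∀ k ∈ b.support, j ∈ J → k ∉ J → P.pairing j k = 0) (i : ι) :
    (∀ j ∈ J, coef b j i = 0) ∨ (∀ j ∉ J, coef b j i = 0) := by
  have key : ∀ i, b.IsPos i → (∀ j ∈ J, coef b j i = 0) ∨ (∀ j ∉ J, coef b j i = 0) := by
    intro i hi
    refine hi.induction_on_add
      (p := fun i => b.IsPos i → (∀ j ∈ J, coef b j i = 0) ∨ (∀ j ∉ J, coef b j i = 0)) ?_ ?_ hi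
    · intro i hi _
      by_cases h : i ∈ J
      · right
        intro j hj
        exact coef_simple_of_ne b hi fun h' => hj (h' ▸ h)
      · left
        intro j hj
        exact coef_simple_of_ne b hi fun h' => h (h' ▸ hj)
    · intro i j k hk ih hj hkpos
      -- The reflection `k - 2 j = i - j` would have coefficients of both signs.
      have hpos : b.IsPos i := by
        rw [RootPairing.Base.isPos_iff']
        have h1 := b.height_add hk
        rw [RootPairing.Base.height_one_of_mem_support hj] at h1
        have h2 := (b.isPos_iff).mp hkpos
        omega
      have hcross : ∀ S : Set ι, (∀ l ∈ b.support, l ∈ S → P.pairing l j = 0) →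
          (∀ l ∉ S, coef b l i = 0) → j ∉ S → False := by
        intro S hS hi0 hjS
        have h0 : P.pairing i j = 0 := by
          rw [pairing_eq_sum_coef b]
          refine Finset.sum_eq_zero fun l hl => ?_
          by_cases hlS : l ∈ S
          · rw [hS l hl hlS, mul_zero]
          · rw [hi0 l hlS, zero_mul]
        have h1 : P.pairing k j = 2 := by
          rw [P.pairing_eq_add_of_root_eq_add hk, h0, P.pairing_same, zero_add]
        obtain ⟨l, hl, hl0⟩ := exists_coef_ne_zero b i
        have hlj : l ≠ j := by
          rintro rfl
          exact hl0 (hi0 l hjS)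
        have h2 : 0 < coef b l (P.reflectionPerm j k) := by
          rw [coef_reflectionPerm, coef_add b hk, coef_simple_of_ne b hj hlj]
          have := (isPos_iff_coef b i).mp hpos l
          omega
        have h3 : coef b j (P.reflectionPerm j k) < 0 := by
          rw [coef_reflectionPerm, coef_add b hk, coef_simple_self b hj, hi0 j hjS, h1]
          norm_num
        exact not_isPos_of_coef_neg b h3 (isPos_of_coef_pos b h2)
      rcases ih hpos with ih | ih
      · left
        intro l hl
        rw [coef_add b hk, ih l hl, zero_add]
        apply coef_simple_of_ne b hj
        rintro rfl
        refine hcross Jᶜ (fun m hm hmJ => ?_) (fun m hm => ih m (not_not.mp hm)) (by simpa using hl)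
        rw [pairing_eq_zero_comm]
        exact hJ l hj m hm hl hmJ
      · right
        intro l hl
        rw [coef_add b hk, ih l hl, zero_add]
        apply coef_simple_of_ne b hj
        rintro rfl
        exact hcross J (fun m hm hmJ => hJ m hm l hj hmJ hl) ih hl
  by_cases hi : b.IsPos i
  · exact key i hi
  · rw [← isPos_neg_iff] at hi
    simpa [coef_neg] using key _ hi

/-- A root that pairs nonnegatively with all simple coroots involves all simple roots of its
component, since irreducible components have a connected Dynkin diagram. -/
theorem coef_pos_of_dominant {i : ι} (hi : b.IsPos i)
    (hd : ∀ j ∈ b.support, 0 ≤ P.pairing i j) {j : ι} (hj : j ∈ b.support)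
    (hc : comp P j = comp P i) : 0 < coef b j i := by
  have hnn := (isPos_iff_coef b i).mp hi
  set J : Set ι := {j | 0 < coef b j i} with hJdef
  have hJ : ∀ j ∈ b.support, ∀ k ∈ b.support, j ∈ J → k ∉ J → P.pairing j k = 0 := by
    intro j hj k hk hjJ hkJ
    have hk0 : coef b k i = 0 := le_antisymm (not_lt.mp hkJ) (hnn k)
    have hle : ∀ l ∈ b.support, coef b l i * P.pairing l k ≤ 0 := by
      intro l hl
      by_cases hlk : l = k
      · rw [hlk, hk0, zero_mul]
      · exact mul_nonpos_of_nonneg_of_nonpos (hnn l) (pairing_nonpos_of_simple b hl hk hlk)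
    have hsum : ∑ l ∈ b.support, coef b l i * P.pairing l k = 0 :=
      le_antisymm (Finset.sum_nonpos hle) (by rw [← pairing_eq_sum_coef]; exact hd k hk)
    have := (Finset.sum_eq_zero_iff_of_nonpos hle).mp hsum j hj
    exact (mul_eq_zero.mp this).resolve_left (ne_of_gt hjJ)
  have hinv : ∀ k l : ι, P.pairing k l ≠ 0 →
      ((∀ m ∉ J, coef b m k = 0) ↔ (∀ m ∉ J, coef b m l = 0)) := by
    -- Roots supported on `J` are orthogonal to roots supported off `J`.
    have horth : ∀ k l : ι, (∀ m ∉ J, coef b m k = 0) → (∀ m ∈ J, coef b m l = 0) →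
        P.pairing k l = 0 := by
      intro k l hk hl
      rw [pairing_eq_sum_coef b]
      refine Finset.sum_eq_zero fun m hm => ?_
      by_cases hmJ : m ∈ J
      · rw [pairing_eq_zero_comm.mp, mul_zero]
        rw [pairing_eq_sum_coef b]
        refine Finset.sum_eq_zero fun n hn => ?_
        by_cases hnJ : n ∈ J
        · rw [hl n hnJ, zero_mul]
        · rw [pairing_eq_zero_comm.mp (hJ m hm n hn hmJ hnJ), mul_zero]
      · rw [hk m hmJ, zero_mul]
    intro k l hkl
    constructor
    · intro hk
      rcases coef_eq_zero_of_separated b hJ l with h | h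
      · exact absurd (horth k l hk h) hkl
      · exact h
    · intro hl
      rcases coef_eq_zero_of_separated b hJ k with h | h
      · exact absurd (pairing_eq_zero_comm.mp (horth l k hl h)) hkl
      · exact h
  let F : Component P → Prop := Quot.lift (fun k => ∀ m ∉ J, coef b m k = 0)
    fun k l hkl => propext (hinv k l hkl)
  have hFi : F (comp P i) := fun m hm => le_antisymm (not_lt.mp hm) (hnn m)
  have hFj : F (comp P j) := hc ▸ hFi
  by_contra hjJ
  have := hFj j hjJ
  rw [coef_simple_self b hj] at this
  norm_num at this

theorem highestRoot_spec (c : Component P) :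
    comp P (highestRoot b c) = c ∧ ∀ j, comp P j = c → b.height j ≤ b.height (highestRoot b c) :=
  (c.exists_highest b).choose_spec

theorem comp_highestRoot (c : Component P) : comp P (highestRoot b c) = c :=
  (highestRoot_spec b c).1

theorem isPos_highestRoot (c : Component P) : b.IsPos (highestRoot b c) := by
  by_contra h
  rw [← isPos_neg_iff] at h
  have h1 := (highestRoot_spec b c).2 (P.reflectionPerm (highestRoot b c) (highestRoot b c))
    (by rw [comp_neg, comp_highestRoot])
  have h2 := (b.isPos_iff).mp h
  have h3 := b.height_reflectionPerm_self (highestRoot b c)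
  change b.height (P.reflectionPerm _ _) = _ at h3
  omega

theorem dominant_of_forall_add_notMem {i : ι} (hi : b.IsPos i)
    (h : ∀ j ∈ b.support, ∀ k, P.root k ≠ P.root i + P.root j) {j : ι} (hj : j ∈ b.support) :
    0 ≤ P.pairing i j := by
  by_contra! hn
  have hne : P.root i ≠ -P.root j := by
    intro h'
    rw [RootPairing.root_eq_neg_iff] at h'
    rw [h', isPos_neg_iff] at hi
    exact hi (RootPairing.Base.isPos_of_mem_support hj)
  obtain ⟨k, hk⟩ := exists_root_eq_add hn hne
  exact h j hj k hk

theorem highestRoot_dominant (c : Component P) {j : ι} (hj : j ∈ b.support) :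
    0 ≤ P.pairing (highestRoot b c) j := by
  refine dominant_of_forall_add_notMem b (isPos_highestRoot b c) (fun k hk l hl => ?_) hj
  have h1 := (highestRoot_spec b c).2 l
    ((comp_eq_of_root_eq_add hl).1.trans (comp_highestRoot b c))
  rw [b.height_add hl, RootPairing.Base.height_one_of_mem_support hk] at h1
  omega

/-- The highest root of a component dominates all roots of the component. A root to which no
simple root can be added has positive pairing with the highest root, so that their difference is
a root, necessarily positive; the general case follows by adding simple roots. -/
theorem coef_le_coef_highestRoot (c : Component P) {i : ι} (hi : comp P i = c) (j : ι) :
    coef b j i ≤ coef b j (highestRoot b c) := by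
  set θ := highestRoot b c with hθ
  have hθpos := isPos_highestRoot b c
  have hθnn := (isPos_iff_coef b θ).mp hθpos
  by_cases hpos : b.IsPos i
  swap
  · exact ((not_isPos_iff_coef b i).mp hpos j).trans (hθnn j)
  obtain ⟨n, hn⟩ : ∃ n : ℕ, b.height θ - b.height i = n :=
    Int.eq_ofNat_of_zero_le (sub_nonneg.mpr ((highestRoot_spec b c).2 i hi))
  induction n using Nat.strong_induction_on generalizing i with
  | _ n ih =>
  by_cases hmax : ∀ j ∈ b.support, ∀ k, P.root k ≠ P.root i + P.root j
  swap
  · push Not at hmax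
    obtain ⟨k, hk, l, hl⟩ := hmax
    have hlc : comp P l = c := (comp_eq_of_root_eq_add hl).1.trans hi
    have hh := b.height_add hl
    have hkpos := RootPairing.Base.isPos_of_mem_support hk
    rw [RootPairing.Base.height_one_of_mem_support hk] at hh
    have hle : b.height l ≤ b.height θ := (highestRoot_spec b c).2 l hlc
    have := ih (n - 1) (by omega) hlc (hpos.add hkpos hl) (by omega)
    rw [coef_add b hl] at this
    have := (isPos_iff_coef b k).mp hkpos j
    omega
  have hdom : ∀ j ∈ b.support, 0 ≤ P.pairing i j := fun j hj =>
    dominant_of_forall_add_notMem b hpos hmax hj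
  have hpair : 0 < P.pairing i θ := by
    rw [pairing_eq_sum_coef b]
    have hnn : ∀ l ∈ b.support, 0 ≤ P.pairing l θ := by
      intro l hl
      by_contra! hneg
      have h1 : 0 ≤ P.pairing θ l := highestRoot_dominant b c hl
      have h2 : P.pairing θ l ≠ 0 := fun h => by
        rw [pairing_eq_zero_comm.mp h] at hneg
        exact lt_irrefl _ hneg
      have h3 := pairing_pos_comm.mp (lt_of_le_of_ne h1 h2.symm)
      omega
    have h2 := pairing_eq_sum_coef b θ θ
    rw [P.pairing_same] at h2
    obtain ⟨l, hl, hl0⟩ : ∃ l ∈ b.support, 0 < P.pairing l θ := by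
      by_contra! h
      have : ∑ l ∈ b.support, coef b l θ * P.pairing l θ ≤ 0 :=
        Finset.sum_nonpos fun l hl => mul_nonpos_of_nonneg_of_nonpos (hθnn l) (h l hl)
      omega
    refine Finset.sum_pos' (fun l hl => mul_nonneg ((isPos_iff_coef b i).mp hpos l) (hnn l hl))
      ⟨l, hl, mul_pos ?_ hl0⟩
    apply coef_pos_of_dominant b hpos hdom hl
    rw [comp_eq_of_pairing_ne_zero hl0.ne', comp_highestRoot, hi]
  by_cases heq : θ = i
  · rw [heq]
  obtain ⟨k, hk⟩ := exists_root_eq_sub (pairing_pos_comm.mp hpair) heq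
  have hadd : P.root θ = P.root k + P.root i := by rw [hk]; abel
  have hkpos : b.IsPos k := by
    rw [RootPairing.Base.isPos_iff']
    have := b.height_add hadd
    omega
  rw [coef_add b hadd]
  have := (isPos_iff_coef b k).mp hkpos j
  omega

theorem coef_highestRoot_pos {j : ι} (hj : j ∈ b.support) {c : Component P} (hc : comp P j = c) :
    0 < coef b j (highestRoot b c) := by
  have := coef_le_coef_highestRoot b c hc j
  rw [coef_simple_self b hj] at this
  omega

theorem eq_highestRoot_of_coef_le {c : Component P} {i : ι} (hi : comp P i = c)
    (h : ∀ j ∈ b.support, coef b j (highestRoot b c) ≤ coef b j i) : i = highestRoot b c := by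
  apply P.root.injective
  rw [root_eq_sum_coef b i, root_eq_sum_coef b (highestRoot b c)]
  exact Finset.sum_congr rfl fun j hj => by
    rw [le_antisymm (coef_le_coef_highestRoot b c hi j) (h j hj)]

theorem mark_of_mem {j : ι} (hj : j ∈ b.support) :
    mark b j = coef b j (highestRoot b (comp P j)) := by
  simp only [mark, coef, hj, dite_true]
  rfl

theorem mark_of_notMem {j : ι} (hj : j ∉ b.support) : mark b j = 1 := by
  simp [mark, hj]

theorem mark_pos (j : ι) : 0 < mark b j := by
  by_cases hj : j ∈ b.support
  · rw [mark_of_mem b hj]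
    exact coef_highestRoot_pos b hj rfl
  · rw [mark_of_notMem b hj]
    exact one_pos

omit [Finite ι] in
theorem shift_of_mem {j : ι} (hj : j ∈ b.support) : shift b j = 0 := by
  simp [shift, hj]

omit [Finite ι] in
theorem shift_of_notMem {j : ι} (hj : j ∉ b.support) : shift b j = -1 := by
  simp [shift, hj]

theorem root_negHighestRoot (c : Component P) :
    P.root (negHighestRoot b c) = -P.root (highestRoot b c) := by
  simp [negHighestRoot]

theorem rootEval_negHighestRoot (c : Component P) (v : V Y) :
    rootEval P (negHighestRoot b c) v = -rootEval P (highestRoot b c) v :=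
  rootEval_neg P _ v

theorem coef_negHighestRoot (c : Component P) (j : ι) :
    coef b j (negHighestRoot b c) = -coef b j (highestRoot b c) :=
  coef_neg b _ j

theorem comp_negHighestRoot (c : Component P) : comp P (negHighestRoot b c) = c := by
  rw [negHighestRoot, comp_neg, comp_highestRoot]

theorem not_isPos_negHighestRoot (c : Component P) : ¬ b.IsPos (negHighestRoot b c) := by
  rw [negHighestRoot, isPos_neg_iff, not_not]
  exact isPos_highestRoot b c

theorem negHighestRoot_notMem (c : Component P) : negHighestRoot b c ∉ b.support := fun h =>
  not_isPos_negHighestRoot b c (RootPairing.Base.isPos_of_mem_support h)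

theorem mem_extSimpleRoots_iff {c : Component P} {i : ι} :
    i ∈ extSimpleRoots b c ↔ i ∈ b.support ∧ comp P i = c ∨ i = negHighestRoot b c := Iff.rfl

theorem comp_of_mem_extSimpleRoots {c : Component P} {i : ι} (hi : i ∈ extSimpleRoots b c) :
    comp P i = c := by
  rcases hi with hi | hi
  · exact hi.2
  · rw [Set.mem_singleton_iff.mp hi, comp_negHighestRoot]

theorem mem_extSimple_of_mem {i : ι} (hi : i ∈ b.support) : i ∈ extSimple b :=
  Set.mem_iUnion.mpr ⟨comp P i, Or.inl ⟨hi, rfl⟩⟩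

theorem negHighestRoot_mem_extSimpleRoots (c : Component P) :
    negHighestRoot b c ∈ extSimpleRoots b c := Or.inr rfl

theorem mem_extSimple_iff {i : ι} :
    i ∈ extSimple b ↔ i ∈ b.support ∨ i = negHighestRoot b (comp P i) := by
  constructor
  · intro h
    obtain ⟨c, hc⟩ := Set.mem_iUnion.mp h
    rw [comp_of_mem_extSimpleRoots b hc]
    exact hc.imp (fun h => h.1) id
  · rintro (h | h)
    · exact mem_extSimple_of_mem b h
    · exact Set.mem_iUnion.mpr ⟨comp P i, Or.inr h⟩

theorem mem_extSimpleRoots_iff' {c : Component P} {i : ι} :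
    i ∈ extSimpleRoots b c ↔ i ∈ extSimple b ∧ comp P i = c := by
  constructor
  · intro h
    exact ⟨Set.mem_iUnion.mpr ⟨c, h⟩, comp_of_mem_extSimpleRoots b h⟩
  · rintro ⟨h, rfl⟩
    exact (mem_extSimple_iff b).mp h |>.imp (fun h => ⟨h, rfl⟩) id

theorem negHighestRoot_mem (c : Component P) : negHighestRoot b c ∈ extSimple b :=
  ((mem_extSimpleRoots_iff' b).mp (negHighestRoot_mem_extSimpleRoots b c)).1

instance : Finite (Component P) := inferInstanceAs (Finite (Quot _))

/-- The finite set underlying `Δ̃_c`. -/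
def extFinset (c : Component P) : Finset ι := (Set.toFinite (extSimpleRoots b c)).toFinset

theorem mem_extFinset {c : Component P} {i : ι} :
    i ∈ extFinset b c ↔ i ∈ extSimpleRoots b c := Set.Finite.mem_toFinset _

/-- A sum over `Δ̃_c` weighted by the marks, in terms of the coefficients of the highest root. -/
theorem sum_extFinset_mark {A : Type*} [CommRing A] (c : Component P) (f : ι → A) :
    ∑ i ∈ extFinset b c, (mark b i : A) * f i =
      f (negHighestRoot b c) + ∑ j ∈ b.support, (coef b j (highestRoot b c) : A) * f j := by
  classical
  have h1 : extFinset b c = insert (negHighestRoot b c) {j ∈ b.support | comp P j = c} := by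
    ext i
    rw [mem_extFinset, mem_extSimpleRoots_iff, Finset.mem_insert, Finset.mem_filter, or_comm]
  rw [h1, Finset.sum_insert, mark_of_notMem b (negHighestRoot_notMem b c), Int.cast_one, one_mul,
    Finset.sum_filter]
  · congr 1
    refine Finset.sum_congr rfl fun j hj => ?_
    split_ifs with h
    · rw [mark_of_mem b hj, h]
    · rw [coef_eq_zero_of_comp_ne b (by rwa [comp_highestRoot]), Int.cast_zero, zero_mul]
  · intro h
    exact negHighestRoot_notMem b c (Finset.mem_filter.mp h).1

/-- The linear relation `∑ n_α α = 0` over `Δ̃_c`. -/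
theorem sum_extFinset_mark_rootEval (c : Component P) (v : V Y) :
    ∑ i ∈ extFinset b c, (mark b i : ℚ) * rootEval P i v = 0 := by
  rw [sum_extFinset_mark, ← rootEval_eq_sum_coef, rootEval_negHighestRoot, neg_add_cancel]

theorem sum_extFinset_mark_coef (c : Component P) (j : ι) :
    ∑ i ∈ extFinset b c, mark b i * coef b j i = 0 := by
  have h := sum_extFinset_mark b c (coef b j)
  simp only [Int.cast_id] at h
  rw [h, coef_negHighestRoot]
  by_cases hj : j ∈ b.support
  · rw [Finset.sum_eq_single_of_mem j hj, coef_simple_self b hj, mul_one, neg_add_cancel]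
    intro k hk hkj
    rw [coef_simple_of_ne b hk hkj.symm, mul_zero]
  · simp [coef_of_notMem b hj]

end Components

/-! ### Affine coordinates and the basis of `Φ(v)` -/

section AffineCoordinates

variable {ι X Y : Type*} [Finite ι] [AddCommGroup X] [AddCommGroup Y]
  [Module.Free ℤ X] [Module.Finite ℤ X] [Module.Free ℤ Y] [Module.Finite ℤ Y]
  {P : RootDatum ι X Y} [IsSemisimple P] (b : P.Base)

theorem finsum_extSimple_coweight (f : ι → ℚ) :
    ∑ᶠ i ∈ extSimple b, f i • fundamentalCoweight b i =
      ∑ j ∈ b.support, f j • fundamentalCoweight b j := by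
  rw [finsum_mem_eq_finite_toFinset_sum _ (Set.toFinite (extSimple b))]
  symm
  refine Finset.sum_subset (fun j hj => ?_) fun j _ hj => ?_
  · rw [Set.Finite.mem_toFinset]
    exact mem_extSimple_of_mem b hj
  · rw [fundamentalCoweight_of_notMem b hj, smul_zero]

open Classical in
/-- The affine coordinates are the normalized values `n_α (⟨α, v⟩ - m_α)`. -/
theorem isAffineCoord_iff (v : V Y) (a : ι → ℚ) :
    IsAffineCoord b v a ↔ a = fun i =>
      if i ∈ extSimple b then (mark b i : ℚ) * (rootEval P i v - shift b i) else 0 := by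
  have hmark : ∀ i, (mark b i : ℚ) ≠ 0 := fun i => by exact_mod_cast (mark_pos b i).ne'
  have hsum : ∀ c : Component P, ∑ᶠ i ∈ extSimpleRoots b c, a i =
      a (negHighestRoot b c) +
        ∑ j ∈ b.support, (coef b j (highestRoot b c) : ℚ) * (a j / mark b j) := by
    intro c
    rw [finsum_mem_eq_finite_toFinset_sum _ (Set.toFinite (extSimpleRoots b c))]
    have h := sum_extFinset_mark b c (fun i => a i / (mark b i : ℚ))
    rw [mark_of_notMem b (negHighestRoot_notMem b c), Int.cast_one, div_one] at h
    rw [← h]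
    exact Finset.sum_congr rfl fun i _ => (mul_div_cancel₀ (a i) (hmark i)).symm
  constructor
  · rintro ⟨h0, h1, h2⟩
    have hsimple : ∀ j ∈ b.support, rootEval P j v = a j / mark b j := by
      intro j hj
      rw [h2, finsum_extSimple_coweight, map_sum, Finset.sum_eq_single_of_mem j hj]
      · rw [map_smul, rootEval_fundamentalCoweight, coef_simple_self b hj]; simp
      · intro k _ hkj
        rw [map_smul, rootEval_fundamentalCoweight, coef_simple_of_ne b hj hkj]; simp
    funext i
    split_ifs with hi
    · rcases (mem_extSimple_iff b).mp hi with hi | hi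
      · rw [hsimple i hi, shift_of_mem b hi, Int.cast_zero, sub_zero,
          mul_div_cancel₀ _ (hmark i)]
      · have h3 := h1 (comp P i)
        rw [hsum, ← hi] at h3
        have hn : i ∉ b.support := by rw [hi]; exact negHighestRoot_notMem b _
        have h4 : rootEval P i v = -∑ j ∈ b.support,
            (coef b j (highestRoot b (comp P i)) : ℚ) * (a j / mark b j) := by
          nth_rewrite 1 [hi]
          rw [rootEval_negHighestRoot, rootEval_eq_sum_coef b]
          congr 1
          exact Finset.sum_congr rfl fun j hj => by rw [hsimple j hj]
        rw [mark_of_notMem b hn, shift_of_notMem b hn, h4]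
        push_cast
        linarith
    · exact h0 i hi
  · rintro rfl
    have hsimple : ∀ j ∈ b.support, (if j ∈ extSimple b then
        (mark b j : ℚ) * (rootEval P j v - shift b j) else 0) / mark b j = rootEval P j v := by
      intro j hj
      rw [if_pos (mem_extSimple_of_mem b hj), shift_of_mem b hj, Int.cast_zero, sub_zero,
        mul_div_cancel_left₀ _ (hmark j)]
    refine ⟨fun i hi => if_neg hi, fun c => ?_, ?_⟩
    · rw [hsum, Finset.sum_congr rfl fun j hj => by rw [hsimple j hj], ← rootEval_eq_sum_coef]
      beta_reduce
      rw [if_pos (negHighestRoot_mem b c), mark_of_notMem b (negHighestRoot_notMem b c),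
        shift_of_notMem b (negHighestRoot_notMem b c), rootEval_negHighestRoot]
      push_cast
      ring
    · rw [finsum_extSimple_coweight, Finset.sum_congr rfl fun j hj => by rw [hsimple j hj]]
      apply ext_rootEval b
      intro i hi
      rw [map_sum, Finset.sum_eq_single_of_mem i hi]
      · rw [map_smul, rootEval_fundamentalCoweight, coef_simple_self b hi]; simp
      · intro k _ hki
        rw [map_smul, rootEval_fundamentalCoweight, coef_simple_of_ne b hi hki]; simp

theorem isAffineCoord_affineCoord (v : V Y) : IsAffineCoord b v (affineCoord b v) :=
  Classical.epsilon_spec ⟨_, (isAffineCoord_iff b v _).mpr rfl⟩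

theorem isAffineCoord_iff_eq (v : V Y) (a : ι → ℚ) :
    IsAffineCoord b v a ↔ a = affineCoord b v := by
  rw [isAffineCoord_iff b v a, ← (isAffineCoord_iff b v _).mp (isAffineCoord_affineCoord b v)]

theorem affineCoord_of_mem {v : V Y} {i : ι} (hi : i ∈ extSimple b) :
    affineCoord b v i = (mark b i : ℚ) * (rootEval P i v - shift b i) := by
  rw [(isAffineCoord_iff b v _).mp (isAffineCoord_affineCoord b v)]
  exact if_pos hi

theorem affineCoord_eq_zero_iff {v : V Y} {i : ι} (hi : i ∈ extSimple b) :
    affineCoord b v i = 0 ↔ rootEval P i v = shift b i := by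
  rw [affineCoord_of_mem b hi, mul_eq_zero, sub_eq_zero]
  exact or_iff_right (by exact_mod_cast (mark_pos b i).ne')

theorem mem_zeroSet_iff {v : V Y} {i : ι} :
    i ∈ zeroSet b v ↔ i ∈ extSimple b ∧ rootEval P i v = shift b i :=
  and_congr_right fun hi => affineCoord_eq_zero_iff b hi

theorem zeroSet_eq (v : V Y) :
    zeroSet b v = {i ∈ extSimple b | rootEval P i v = shift b i} :=
  Set.ext fun _ => mem_zeroSet_iff b

theorem zeroSet_subset_extSimple (v : V Y) : zeroSet b v ⊆ extSimple b := fun _ h => h.1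

theorem zeroSet_subset_integralRoots (v : V Y) : zeroSet b v ⊆ integralRoots P v :=
  fun i hi => ⟨shift b i, ((mem_zeroSet_iff b).mp hi).2⟩

/-- Every `Δ̃_c` has an element outside `I_v`, as its affine coordinates add up to `1`. -/
theorem exists_mem_extSimpleRoots_notMem_zeroSet (v : V Y) (c : Component P) :
    ∃ i ∈ extSimpleRoots b c, i ∉ zeroSet b v := by
  by_contra! h
  have h1 := (isAffineCoord_affineCoord b v).2.1 c
  rw [finsum_mem_congr rfl (g := fun _ => (0 : ℚ)) fun i hi => (h i hi).2] at h1
  simp at h1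

omit [Module.Free ℤ X] [Module.Finite ℤ X] [Module.Free ℤ Y] [Module.Finite ℤ Y]
  [IsSemisimple P] in
/-- A set of elements of `Δ̃` missing an element of each `Δ̃_c` is linearly independent. -/
theorem linearIndepOn_of_subset_extSimple {I : Set ι} (hI : I ⊆ extSimple b)
    (h : ∀ c : Component P, ∃ i ∈ extSimpleRoots b c, i ∉ I) : LinearIndepOn ℤ P.root I := by
  classical
  rw [linearIndepOn_iff']
  intro s g hs h0
  set g' : ι → ℤ := fun i => if i ∈ s then g i else 0 with hg'
  have hcoef : ∀ j ∈ b.support,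
      g' j - g' (negHighestRoot b (comp P j)) * coef b j (highestRoot b (comp P j)) = 0 := by
    intro j hj
    set n := negHighestRoot b (comp P j) with hn
    have hjn : j ≠ n := fun h => negHighestRoot_notMem b _ (hn ▸ h ▸ hj)
    have h1 : ∑ i ∈ s, g i * coef b j i = 0 := by
      have h2 : ∑ l ∈ b.support, (∑ i ∈ s, g i * coef b l i) • P.root l =
          ∑ l ∈ b.support, (0 : ℤ) • P.root l := by
        simp only [Finset.sum_smul, mul_smul, zero_smul, Finset.sum_const_zero]
        rw [Finset.sum_comm, ← h0]
        simp only [← Finset.smul_sum, ← root_eq_sum_coef]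
      exact linearIndep_simple b (g := fun _ => 0) h2 hj
    have h2 : ∑ i ∈ s, g i * coef b j i = ∑ i ∈ s ∪ {j, n}, g' i * coef b j i := by
      rw [← Finset.sum_subset Finset.subset_union_left]
      · exact Finset.sum_congr rfl fun i hi => by simp [hg', hi]
      · intro i _ hi
        simp [hg', hi]
    have h3 : ∑ i ∈ s ∪ {j, n}, g' i * coef b j i = ∑ i ∈ {j, n}, g' i * coef b j i := by
      symm
      refine Finset.sum_subset Finset.subset_union_right fun i hi hi' => ?_
      rw [Finset.mem_insert, Finset.mem_singleton, not_or] at hi'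
      have his : i ∈ s := by
        rcases Finset.mem_union.mp hi with hi | hi
        · exact hi
        · rw [Finset.mem_insert, Finset.mem_singleton] at hi
          exact absurd hi (by tauto)
      rcases (mem_extSimple_iff b).mp (hI (hs his)) with h | h
      · rw [coef_simple_of_ne b h (Ne.symm hi'.1), mul_zero]
      · rw [coef_eq_zero_of_comp_ne b, mul_zero]
        intro hc
        exact hi'.2 (by rw [hn, hc]; exact h)
    rw [h1, h3, Finset.sum_pair hjn, coef_simple_self b hj, hn, coef_negHighestRoot] at h2
    linarith
  have hzero : ∀ c : Component P, g' (negHighestRoot b c) = 0 := by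
    intro c
    obtain ⟨k, hk, hkI⟩ := h c
    have hk0 : g' k = 0 := if_neg fun hks => hkI (hs hks)
    rcases (mem_extSimpleRoots_iff b).mp hk with ⟨hk1, rfl⟩ | rfl
    · have := hcoef k hk1
      rw [hk0, zero_sub, neg_eq_zero, mul_eq_zero] at this
      exact this.resolve_right (coef_highestRoot_pos b hk1 rfl).ne'
    · exact hk0
  intro i hi
  have hgi : g' i = g i := if_pos hi
  rw [← hgi]
  rcases (mem_extSimple_iff b).mp (hI (hs hi)) with h | h
  · have := hcoef i h
    rwa [hzero, zero_mul, sub_zero] at this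
  · rw [h]
    exact hzero _

omit [Finite ι] [Module.Free ℤ X] [Module.Finite ℤ X] [Module.Free ℤ Y] [Module.Finite ℤ Y]
  [IsSemisimple P] in
theorem sum_smul_mem_closure {I : Set ι} {f : ι → ℤ} (hf : ∀ j ∈ b.support, 0 ≤ f j)
    (hI : ∀ j ∈ b.support, f j ≠ 0 → j ∈ I) :
    ∑ j ∈ b.support, f j • P.root j ∈ AddSubmonoid.closure (P.root '' I) := by
  refine AddSubmonoid.sum_mem _ fun j hj => ?_
  by_cases h0 : f j = 0
  · rw [h0, zero_smul]
    exact zero_mem _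
  · obtain ⟨n, hn⟩ := Int.eq_ofNat_of_zero_le (hf j hj)
    rw [hn, natCast_zsmul]
    exact nsmul_mem (AddSubmonoid.subset_closure (Set.mem_image_of_mem _ (hI j hj h0))) n

variable {b} {v : V Y} (hv : v ∈ alcove b)

include hv

omit [Module.Free ℤ X] [Module.Finite ℤ X] [Module.Free ℤ Y] [Module.Finite ℤ Y]
  [IsSemisimple P] in
theorem rootEval_simple_nonneg {j : ι} (hj : j ∈ b.support) : 0 ≤ rootEval P j v := by
  have := hv j (mem_extSimple_of_mem b hj)
  rwa [shift_of_mem b hj, Int.cast_zero] at this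

omit [Module.Free ℤ X] [Module.Finite ℤ X] [Module.Free ℤ Y] [Module.Finite ℤ Y]
  [IsSemisimple P] in
theorem rootEval_highestRoot_le (c : Component P) : rootEval P (highestRoot b c) v ≤ 1 := by
  have := hv _ (negHighestRoot_mem b c)
  rw [shift_of_notMem b (negHighestRoot_notMem b c), rootEval_negHighestRoot] at this
  push_cast at this
  linarith

omit [Module.Free ℤ X] [Module.Finite ℤ X] [Module.Free ℤ Y] [Module.Finite ℤ Y]
  [IsSemisimple P] in
theorem rootEval_nonneg_of_isPos {i : ι} (hi : b.IsPos i) : 0 ≤ rootEval P i v := by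
  rw [rootEval_eq_sum_coef b]
  refine Finset.sum_nonneg fun j hj => mul_nonneg ?_ (rootEval_simple_nonneg hv hj)
  exact_mod_cast (isPos_iff_coef b i).mp hi j

omit [Module.Free ℤ X] [Module.Finite ℤ X] [Module.Free ℤ Y] [Module.Finite ℤ Y]
  [IsSemisimple P] in
theorem rootEval_le_one (i : ι) : rootEval P i v ≤ 1 := by
  refine le_trans ?_ (rootEval_highestRoot_le hv (comp P i))
  rw [rootEval_eq_sum_coef b i, rootEval_eq_sum_coef b (highestRoot b (comp P i))]
  refine Finset.sum_le_sum fun j hj => mul_le_mul_of_nonneg_right ?_ (rootEval_simple_nonneg hv hj)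
  exact_mod_cast coef_le_coef_highestRoot b _ rfl j

/-- A positive root with an integral value at a point of the alcove takes the value `0` or `1`
there; in the first case it is a combination of elements of `I_v`, in the second case its
negative is. -/
theorem closure_of_isPos_integral {i : ι} (hi : b.IsPos i) (hint : i ∈ integralRoots P v) :
    (rootEval P i v = 0 ∧ P.root i ∈ AddSubmonoid.closure (P.root '' zeroSet b v)) ∨
    (rootEval P i v = 1 ∧ -P.root i ∈ AddSubmonoid.closure (P.root '' zeroSet b v)) := by
  have hcnn := (isPos_iff_coef b i).mp hi
  have hsimple : ∀ j ∈ b.support, rootEval P j v = 0 → j ∈ zeroSet b v := fun j hj h =>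
    (mem_zeroSet_iff b).mpr ⟨mem_extSimple_of_mem b hj, by rw [h, shift_of_mem b hj]; simp⟩
  have h0 := rootEval_nonneg_of_isPos hv hi
  have h1 := rootEval_le_one hv i
  obtain ⟨n, hn⟩ := hint
  rw [hn] at h0 h1
  have hn' : n = 0 ∨ n = 1 := by
    have h0' : 0 ≤ n := by exact_mod_cast h0
    have h1' : n ≤ 1 := by exact_mod_cast h1
    omega
  rcases hn' with rfl | rfl
  · left
    rw [Int.cast_zero] at hn
    refine ⟨hn, ?_⟩
    rw [root_eq_sum_coef b i]
    refine sum_smul_mem_closure b (fun j _ => hcnn j) fun j hj hj0 => hsimple j hj ?_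
    rw [rootEval_eq_sum_coef b, Finset.sum_eq_zero_iff_of_nonneg] at hn
    · exact (mul_eq_zero.mp (hn j hj)).resolve_left (by exact_mod_cast hj0)
    · exact fun j hj => mul_nonneg (by exact_mod_cast hcnn j) (rootEval_simple_nonneg hv hj)
  · right
    rw [Int.cast_one] at hn
    refine ⟨hn, ?_⟩
    -- Here `-α = -α̃ + (α̃ - α)`, and `α̃ - α` vanishes at `v`.
    set θ := highestRoot b (comp P i) with hθ
    have hle : ∀ j, 0 ≤ coef b j θ - coef b j i := fun j =>
      sub_nonneg.mpr (coef_le_coef_highestRoot b _ rfl j)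
    have hdiff : ∑ j ∈ b.support, ((coef b j θ - coef b j i : ℤ) : ℚ) * rootEval P j v =
        rootEval P θ v - 1 := by
      rw [← hn, rootEval_eq_sum_coef b θ, rootEval_eq_sum_coef b i, ← Finset.sum_sub_distrib]
      refine Finset.sum_congr rfl fun j _ => ?_
      push_cast
      ring
    have hnn : ∀ j ∈ b.support, 0 ≤ ((coef b j θ - coef b j i : ℤ) : ℚ) * rootEval P j v :=
      fun j hj => mul_nonneg (by exact_mod_cast hle j) (rootEval_simple_nonneg hv hj)
    have hθ1 : rootEval P θ v = 1 := by
      have h2 := Finset.sum_nonneg hnn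
      have h3 := rootEval_highestRoot_le hv (comp P i)
      rw [← hθ] at h3
      linarith
    rw [hθ1, sub_self, Finset.sum_eq_zero_iff_of_nonneg hnn] at hdiff
    have hneg : -P.root i = P.root (negHighestRoot b (comp P i)) +
        ∑ j ∈ b.support, (coef b j θ - coef b j i) • P.root j := by
      simp only [sub_smul, Finset.sum_sub_distrib, ← root_eq_sum_coef]
      rw [root_negHighestRoot, ← hθ]
      abel
    rw [hneg]
    refine add_mem (AddSubmonoid.subset_closure ⟨_, ?_, rfl⟩) (sum_smul_mem_closure b
      (fun j _ => hle j) fun j hj hj0 => hsimple j hj ?_)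
    · rw [mem_zeroSet_iff, rootEval_negHighestRoot, ← hθ, hθ1,
        shift_of_notMem b (negHighestRoot_notMem b _)]
      exact ⟨negHighestRoot_mem b _, by norm_num⟩
    · exact (mul_eq_zero.mp (hdiff j hj)).resolve_left (by exact_mod_cast hj0)

theorem isRootBasis_zeroSet : IsRootBasis P (zeroSet b v) (integralRoots P v) := by
  refine ⟨zeroSet_subset_integralRoots b v,
    linearIndepOn_of_subset_extSimple b (zeroSet_subset_extSimple b v)
      (exists_mem_extSimpleRoots_notMem_zeroSet b v), fun i hi => ?_⟩
  by_cases hpos : b.IsPos i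
  · exact (closure_of_isPos_integral hv hpos hi).imp (fun h => h.2) fun h => h.2
  · rw [← isPos_neg_iff] at hpos
    have hi' : P.reflectionPerm i i ∈ integralRoots P v := by
      obtain ⟨n, hn⟩ := hi
      exact ⟨-n, by rw [rootEval_neg, hn, Int.cast_neg]⟩
    have h := closure_of_isPos_integral hv hpos hi'
    rw [RootPairing.root_reflectionPerm, RootPairing.reflection_apply_self, neg_neg] at h
    exact h.symm.imp (fun h => h.2) fun h => h.2

end AffineCoordinates

/-! ### The Weyl group: words, dominance and parabolic subgroups -/

section WeylGroup

variable {ι X Y : Type*} [AddCommGroup X] [AddCommGroup Y] {P : RootDatum ι X Y}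

theorem weylGroup_ext {w w' : P.weylGroup} (h : ∀ x : X, w • x = w' • x) : w = w' := by
  apply Subtype.ext
  apply RootPairing.Equiv.weightHom_injective P
  ext x
  exact h x

theorem ofIdx_reflectionPerm (i j : ι) :
    RootPairing.weylGroup.ofIdx P (P.reflectionPerm j i) =
      RootPairing.weylGroup.ofIdx P j * RootPairing.weylGroup.ofIdx P i *
        RootPairing.weylGroup.ofIdx P j := by
  apply weylGroup_ext
  intro x
  exact LinearEquiv.congr_fun (P.reflection_reflectionPerm (i := i) (j := j)) x

/-- The reflection in a Weyl translate of a root is the conjugate reflection. -/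
theorem ofIdx_smul_idx (w : P.weylGroup) (i : ι) :
    RootPairing.weylGroup.ofIdx P (w • i) = w * RootPairing.weylGroup.ofIdx P i * w⁻¹ := by
  obtain ⟨w, hw⟩ := w
  induction hw using RootPairing.weylGroup.induction generalizing i with
  | mem j =>
    have h1 : (⟨_, P.reflection_mem_weylGroup j⟩ : P.weylGroup) =
      RootPairing.weylGroup.ofIdx P j := rfl
    rw [h1, ofIdx_smul_eq, ofIdx_reflectionPerm, ofIdx_inv]
  | one =>
    have h1 : (⟨1, one_mem _⟩ : P.weylGroup) = 1 := rfl
    rw [h1, one_smul, one_mul, inv_one, mul_one]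
  | mul x y hx hy ihx ihy =>
    have h1 : (⟨x * y, mul_mem hx hy⟩ : P.weylGroup) = ⟨x, hx⟩ * ⟨y, hy⟩ := rfl
    rw [h1, mul_smul, ihx, ihy, mul_inv_rev]
    group

theorem ofIdx_mem_reflectionSubgroup {S : Set ι} {i : ι} (hi : i ∈ S) :
    RootPairing.weylGroup.ofIdx P i ∈ reflectionSubgroup P S :=
  Subgroup.subset_closure ⟨i, hi, rfl⟩

theorem reflectionSubgroup_le {S : Set ι} {H : Subgroup P.weylGroup}
    (h : ∀ i ∈ S, RootPairing.weylGroup.ofIdx P i ∈ H) : reflectionSubgroup P S ≤ H := by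
  rw [reflectionSubgroup, Subgroup.closure_le]
  rintro _ ⟨i, hi, rfl⟩
  exact h i hi

theorem exists_list_of_mem_reflectionSubgroup {S : Set ι} {w : P.weylGroup}
    (hw : w ∈ reflectionSubgroup P S) :
    ∃ L : List ι, (∀ i ∈ L, i ∈ S) ∧ (L.map (RootPairing.weylGroup.ofIdx P)).prod = w := by
  induction hw using Subgroup.closure_induction with
  | mem x hx =>
    obtain ⟨i, hi, rfl⟩ := hx
    exact ⟨[i], by simpa using hi, by simp⟩
  | one => exact ⟨[], by simp, by simp⟩
  | mul x y _ _ hx hy =>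
    obtain ⟨L, hL, rfl⟩ := hx
    obtain ⟨L', hL', rfl⟩ := hy
    exact ⟨L ++ L', by simpa [or_imp, forall_and] using ⟨hL, hL'⟩, by simp⟩
  | inv x _ hx =>
    obtain ⟨L, hL, rfl⟩ := hx
    refine ⟨L.reverse, by simpa using hL, ?_⟩
    rw [List.prod_inv_reverse, List.map_reverse, List.map_map]
    congr 3
    funext i
    exact (ofIdx_inv i).symm

variable [Finite ι] [P.IsReduced] (b : P.Base)

theorem reflectionSubgroup_support : reflectionSubgroup P (b.support : Set ι) = ⊤ := by
  have h1 : ∀ i, RootPairing.weylGroup.ofIdx P i ∈ reflectionSubgroup P (b.support : Set ι) := by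
    intro i
    refine b.induction_reflect i
      (p := fun i => RootPairing.weylGroup.ofIdx P i ∈ reflectionSubgroup P (b.support : Set ι))
      (fun i hi => ?_) (fun i hi => ofIdx_mem_reflectionSubgroup hi) (fun i j hi hj => ?_)
    · rw [ofIdx_reflectionPerm]
      exact mul_mem (mul_mem hi hi) hi
    · rw [ofIdx_reflectionPerm]
      have hj' := ofIdx_mem_reflectionSubgroup (P := P) (S := (b.support : Set ι)) hj
      exact mul_mem (mul_mem hj' hi) hj'
  rw [eq_top_iff]
  rintro ⟨w, hw⟩ -
  induction hw using RootPairing.weylGroup.induction with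
  | mem i => exact h1 i
  | one => exact one_mem _
  | mul x y hx hy ihx ihy => exact mul_mem ihx ihy

/-- The exchange condition: if a word of simple reflections makes the simple root `i` negative,
then its product with the reflection in `i` is given by a shorter word. -/
theorem exchange (L : List ι) (hL : ∀ j ∈ L, j ∈ b.support) {i : ι} (hi : i ∈ b.support) :
    b.IsPos ((L.map (RootPairing.weylGroup.ofIdx P)).prod • i) ∨
    ∃ L' : List ι, (∀ j ∈ L', j ∈ b.support) ∧ L'.length + 1 = L.length ∧
      (L.map (RootPairing.weylGroup.ofIdx P)).prod * RootPairing.weylGroup.ofIdx P i =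
        (L'.map (RootPairing.weylGroup.ofIdx P)).prod := by
  induction L with
  | nil =>
    left
    simpa using RootPairing.Base.isPos_of_mem_support hi
  | cons j L ih =>
    have hj : j ∈ b.support := hL j List.mem_cons_self
    have hL1 : ∀ j ∈ L, j ∈ b.support := fun k hk => hL k (List.mem_cons_of_mem _ hk)
    rw [List.map_cons, List.prod_cons]
    set u := (L.map (RootPairing.weylGroup.ofIdx P)).prod with hu
    rcases ih hL1 with h | ⟨L', hL', hlen, hprod⟩
    · by_cases hji : u • i = j
      · right
        refine ⟨L, hL1, by simp, ?_⟩
        rw [← hji, ofIdx_smul_idx, ← hu]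
        calc u * RootPairing.weylGroup.ofIdx P i * u⁻¹ * u * RootPairing.weylGroup.ofIdx P i
            = u * (RootPairing.weylGroup.ofIdx P i * RootPairing.weylGroup.ofIdx P i) := by group
          _ = u := by rw [ofIdx_mul_self, mul_one]
      · left
        rw [mul_smul, ofIdx_smul_eq]
        exact h.reflectionPerm hj hji
    · right
      refine ⟨j :: L', ?_, by simp [hlen], ?_⟩
      · intro k hk
        rcases List.mem_cons.mp hk with rfl | hk
        · exact hj
        · exact hL' k hk
      · rw [List.map_cons, List.prod_cons, mul_assoc, hprod]

omit [Finite ι] [P.IsReduced] in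
theorem rootEval_nonneg_of_dominant {b : P.Base} {x : V Y}
    (hx : ∀ j ∈ b.support, 0 ≤ rootEval P j x) {i : ι} (hi : b.IsPos i) : 0 ≤ rootEval P i x := by
  rw [rootEval_eq_sum_coef b]
  refine Finset.sum_nonneg fun j hj => mul_nonneg ?_ (hx j hj)
  exact_mod_cast (isPos_iff_coef b i).mp hi j

/-- If `x` and `w x` are dominant, then `w` is a product of simple reflections fixing `x`. -/
theorem mem_reflectionSubgroup_of_dominant {x : V Y} (hx : ∀ j ∈ b.support, 0 ≤ rootEval P j x)
    (w : P.weylGroup) (hw : ∀ j ∈ b.support, 0 ≤ rootEval P j (weylRep P w x)) :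
    w ∈ reflectionSubgroup P {j | j ∈ b.support ∧ rootEval P j x = 0} := by
  obtain ⟨L, hL, rfl⟩ := exists_list_of_mem_reflectionSubgroup
    (show w ∈ reflectionSubgroup P (b.support : Set ι) by
      rw [reflectionSubgroup_support]; trivial)
  obtain ⟨n, hn⟩ : ∃ n, L.length = n := ⟨_, rfl⟩
  induction n using Nat.strong_induction_on generalizing L with
  | _ n ih =>
  rcases List.eq_nil_or_concat L with rfl | ⟨L1, i, rfl⟩
  · simp [one_mem]
  have hi : i ∈ b.support := hL i (by simp)
  have hL1 : ∀ j ∈ L1, j ∈ b.support := fun k hk => hL k (by simp [hk])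
  have hprod : ((L1.concat i).map (RootPairing.weylGroup.ofIdx P)).prod =
      (L1.map (RootPairing.weylGroup.ofIdx P)).prod * RootPairing.weylGroup.ofIdx P i := by
    simp
  have hlen : L1.length + 1 = n := by simpa using hn
  rw [hprod] at hw ⊢
  rcases exchange b L1 hL1 hi with h | ⟨L', hL', hlen', hprod'⟩
  · set u := (L1.map (RootPairing.weylGroup.ofIdx P)).prod with hu
    have h1 : rootEval P i x ≤ 0 := by
      rw [← rootEval_smul_weylRep (u * RootPairing.weylGroup.ofIdx P i) i x, mul_smul,
        ofIdx_smul_eq, smul_neg_idx, rootEval_neg, neg_nonpos]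
      exact rootEval_nonneg_of_dominant hw h
    have h2 : rootEval P i x = 0 := le_antisymm h1 (hx i hi)
    refine mul_mem (ih L1.length (by omega) L1 hL1 (fun j hj => ?_) rfl)
      (ofIdx_mem_reflectionSubgroup ⟨hi, h2⟩)
    have h3 := hw j hj
    rwa [weylRep_mul_apply, (weylRep_ofIdx_eq_self_iff i x).mpr h2] at h3
  · rw [hprod'] at hw ⊢
    exact ih L'.length (by omega) L' hL' hw rfl

omit [P.IsReduced] [Finite ι] in
theorem weylRep_eq_self_of_mem_reflectionSubgroup {S : Set ι} {x : V Y}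
    (hS : ∀ i ∈ S, rootEval P i x = 0) {w : P.weylGroup} (hw : w ∈ reflectionSubgroup P S) :
    weylRep P w x = x := by
  induction hw using Subgroup.closure_induction with
  | mem u hu =>
    obtain ⟨i, hi, rfl⟩ := hu
    exact (weylRep_ofIdx_eq_self_iff i x).mpr (hS i hi)
  | one => simp
  | mul u u' _ _ hu hu' => rw [weylRep_mul_apply, hu', hu]
  | inv u _ hu => nth_rewrite 1 [← hu, weylRep_inv_apply]; rfl

omit [P.IsReduced] [Finite ι] in
/-- The component in `W_c` of an element of the Weyl group. -/
theorem exists_component (c : Component P) (w : P.weylGroup) :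
    ∃ w' : P.weylGroup, (∀ j, comp P j = c → w' • j = w • j) ∧
      ∀ j, comp P j ≠ c → w' • j = j := by
  obtain ⟨w, hw⟩ := w
  induction hw using RootPairing.weylGroup.induction with
  | mem i =>
    by_cases hi : comp P i = c
    · refine ⟨RootPairing.weylGroup.ofIdx P i, fun j _ => rfl, fun j hj => ?_⟩
      rw [ofIdx_smul_eq]
      apply P.reflectionPerm_eq_of_pairing_eq_zero
      by_contra h
      exact hj ((comp_eq_of_pairing_ne_zero h).trans hi)
    · refine ⟨1, fun j hj => ?_, fun j _ => one_smul _ j⟩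
      rw [one_smul]
      symm
      apply P.reflectionPerm_eq_of_pairing_eq_zero
      by_contra h
      exact hi ((comp_eq_of_pairing_ne_zero h).symm.trans hj)
  | one => exact ⟨1, fun j _ => rfl, fun j _ => one_smul _ j⟩
  | mul x y hx hy ihx ihy =>
    obtain ⟨x', hx1, hx2⟩ := ihx
    obtain ⟨y', hy1, hy2⟩ := ihy
    refine ⟨x' * y', fun j hj => ?_, fun j hj => ?_⟩
    · have h1 : (⟨x * y, mul_mem hx hy⟩ : P.weylGroup) • j =
        (⟨x, hx⟩ : P.weylGroup) • (⟨y, hy⟩ : P.weylGroup) • j := mul_smul x y j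
      rw [h1, mul_smul, hy1 j hj, hx1]
      rw [comp_smul, hj]
    · rw [mul_smul, hy2 j hj, hx2 j hj]

variable [Module.Free ℤ X] [Module.Finite ℤ X] [Module.Free ℤ Y] [Module.Finite ℤ Y]
  [IsSemisimple P]

/-- An element of the Weyl group preserving the positive roots is trivial. -/
theorem eq_one_of_isPos_smul {w : P.weylGroup} (hw : ∀ i, b.IsPos i → b.IsPos (w • i)) :
    w = 1 := by
  obtain ⟨x, hx⟩ := exists_rootEval_eq b (P := P) fun _ => 1
  have hinv : ∀ i, b.IsPos i → b.IsPos (w⁻¹ • i) := by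
    intro i hi
    by_contra h
    rw [← isPos_neg_iff, ← smul_neg_idx] at h
    have := hw _ h
    rw [smul_inv_smul, isPos_neg_iff] at this
    exact this hi
  have h := mem_reflectionSubgroup_of_dominant b (x := x) (fun j hj => by rw [hx j hj]; norm_num)
    w fun j hj => by
      rw [rootEval_weylRep]
      exact rootEval_nonneg_of_dominant (fun j hj => by rw [hx j hj]; norm_num)
        (hinv j (RootPairing.Base.isPos_of_mem_support hj))
  have hempty : {j | j ∈ b.support ∧ rootEval P j x = 0} = (∅ : Set ι) := by
    ext j
    simp only [Set.mem_ofPred_eq, Set.mem_empty_iff_false, iff_false, not_and]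
    intro hj
    rw [hx j hj]
    norm_num
  rw [hempty, reflectionSubgroup, Set.image_empty, Subgroup.closure_empty] at h
  exact Subgroup.mem_bot.mp h

/-- An element of the Weyl group preserving the positive roots of a component acts trivially on
this component. -/
theorem smul_eq_self_of_isPos_smul (c : Component P) {w : P.weylGroup}
    (hw : ∀ j ∈ b.support, comp P j = c → b.IsPos (w • j)) {j : ι} (hj : comp P j = c) :
    w • j = j := by
  obtain ⟨w', h1, h2⟩ := exists_component c w
  have h3 : w' = 1 := by
    apply eq_one_of_isPos_smul b
    intro i hi
    apply isPos_smul_of_forall b hi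
    intro k hk _
    by_cases hkc : comp P k = c
    · rw [h1 k hkc]
      exact hw k hk hkc
    · rw [h2 k hkc]
      exact RootPairing.Base.isPos_of_mem_support hk
  rw [← h1 j hj, h3, one_smul]

end WeylGroup

section Form

variable {ι X Y : Type*} [Finite ι] [AddCommGroup X] [AddCommGroup Y] {P : RootDatum ι X Y}

variable (P) in
/-- The Weyl-invariant symmetric form `∑ ⟨α, x⟩ ⟨α, y⟩` on `V`, the sum running over all roots. -/
def weylForm (x y : V Y) : ℚ :=
  letI := Fintype.ofFinite ι
  ∑ i : ι, rootEval P i x * rootEval P i y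

theorem weylForm_weylRep (w : P.weylGroup) (x y : V Y) :
    weylForm P (weylRep P w x) (weylRep P w y) = weylForm P x y := by
  let := Fintype.ofFinite ι
  change ∑ i : ι, _ = ∑ i : ι, _
  simp only [rootEval_weylRep]
  exact Equiv.sum_comp (MulAction.toPerm w⁻¹) fun i => rootEval P i x * rootEval P i y

theorem weylForm_sub_smul (x y z : V Y) (q : ℚ) :
    weylForm P x (y - q • z) = weylForm P x y - q * weylForm P x z := by
  let := Fintype.ofFinite ι
  change ∑ i : ι, _ = ∑ i : ι, _ - q * ∑ i : ι, _
  rw [Finset.mul_sum, ← Finset.sum_sub_distrib]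
  refine Finset.sum_congr rfl fun i _ => ?_
  simp only [map_sub, map_smul, smul_eq_mul]
  ring

theorem weylForm_comm (x y : V Y) : weylForm P x y = weylForm P y x := by
  let := Fintype.ofFinite ι
  change ∑ i : ι, _ = ∑ i : ι, _
  exact Finset.sum_congr rfl fun i _ => mul_comm _ _

theorem weylForm_coroot_self_pos (i : ι) :
    0 < weylForm P ((1 : ℚ) ⊗ₜ[ℤ] P.coroot i) ((1 : ℚ) ⊗ₜ[ℤ] P.coroot i) := by
  let := Fintype.ofFinite ι
  refine Finset.sum_pos' (fun j _ => mul_self_nonneg _) ⟨i, Finset.mem_univ i, ?_⟩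
  rw [rootEval_coroot, P.pairing_same]
  norm_num

/-- Under the form, the coroot of `i` is a positive multiple of the functional given by `i`. -/
theorem two_mul_weylForm_coroot (i : ι) (x : V Y) :
    2 * weylForm P x ((1 : ℚ) ⊗ₜ[ℤ] P.coroot i) = rootEval P i x *
      weylForm P ((1 : ℚ) ⊗ₜ[ℤ] P.coroot i) ((1 : ℚ) ⊗ₜ[ℤ] P.coroot i) := by
  set a : V Y := (1 : ℚ) ⊗ₜ[ℤ] P.coroot i with ha
  have h := weylForm_weylRep (RootPairing.weylGroup.ofIdx P i) x a
  have h1 : weylRep P (RootPairing.weylGroup.ofIdx P i) a = 0 - (1 : ℚ) • a := by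
    rw [weylRep_ofIdx, ← ha]
    have : rootEval P i a = 2 := by rw [ha, rootEval_coroot, P.pairing_same]; norm_num
    rw [this]
    module
  have h0 : ∀ y : V Y, weylForm P y 0 = 0 := by
    intro y
    have := weylForm_sub_smul (P := P) y 0 0 1
    simp only [smul_zero, one_mul, sub_self] at this
    exact this
  rw [h1, weylForm_sub_smul, h0, weylRep_ofIdx, weylForm_comm _ a, weylForm_sub_smul,
    weylForm_comm a x] at h
  linarith

/-- Let `H` contain the reflections in the elements of `I`, and suppose that some vector is
strictly positive on `I`. Then every vector has an `H`-translate that is nonnegative on `I`,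
namely one that maximizes the form with the given vector. -/
theorem exists_weylRep_nonneg {I : Set ι} {H : Subgroup P.weylGroup}
    (hH : ∀ i ∈ I, RootPairing.weylGroup.ofIdx P i ∈ H) {d : V Y}
    (hd : ∀ i ∈ I, 0 < rootEval P i d) (x : V Y) :
    ∃ h ∈ H, ∀ i ∈ I, 0 ≤ rootEval P i (weylRep P h x) := by
  let := Fintype.ofFinite ι
  let f : P.weylGroup → ℚ := fun h => weylForm P d (weylRep P h x)
  have hfin : (f '' H).Finite := by
    let g : Equiv.Perm ι → ℚ := fun σ => ∑ i : ι, rootEval P i d * rootEval P (σ i) x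
    refine (Set.finite_range g).subset ?_
    rintro _ ⟨h, -, rfl⟩
    refine ⟨MulAction.toPerm h⁻¹, ?_⟩
    change ∑ i : ι, _ = ∑ i : ι, _
    exact Finset.sum_congr rfl fun i _ => by rw [rootEval_weylRep]; rfl
  obtain ⟨_, ⟨h, hh, rfl⟩, hmax⟩ := Set.exists_max_image (f '' H) id hfin
    ⟨f 1, 1, one_mem H, rfl⟩
  refine ⟨h, hh, fun i hi => ?_⟩
  by_contra! hneg
  have h1 := hmax _ ⟨RootPairing.weylGroup.ofIdx P i * h, mul_mem (hH i hi) hh, rfl⟩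
  simp only [id_eq, f] at h1
  rw [weylRep_mul_apply, weylRep_ofIdx, weylForm_sub_smul] at h1
  have h2 := two_mul_weylForm_coroot (P := P) i d
  have h3 := mul_pos (hd i hi) (weylForm_coroot_self_pos (P := P) i)
  have h4 : 0 < weylForm P d ((1 : ℚ) ⊗ₜ[ℤ] P.coroot i) := by linarith
  nlinarith

end Form

section Parabolic

variable {ι X Y : Type*} [Finite ι] [AddCommGroup X] [AddCommGroup Y]
  [Module.Free ℤ X] [Module.Finite ℤ X] [Module.Free ℤ Y] [Module.Finite ℤ Y]
  {P : RootDatum ι X Y} [P.IsReduced] [IsSemisimple P] (b : P.Base)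

/-- A subgroup of the Weyl group lies in a proper parabolic subgroup if and only if it fixes a
nonzero vector: stabilizers of vectors are parabolic subgroups. -/
theorem exists_isParabolic_iff (H : Subgroup P.weylGroup) :
    (∃ K : Subgroup P.weylGroup, IsParabolic b K ∧ K ≠ ⊤ ∧ H ≤ K) ↔
      ∃ x : V Y, x ≠ 0 ∧ ∀ w ∈ H, weylRep P w x = x := by
  constructor
  · rintro ⟨_, ⟨I, hI, w, rfl⟩, hne, hle⟩
    have hIne : ∃ j ∈ b.support, j ∉ I := by
      by_contra! h
      apply hne
      rw [show I = (b.support : Set ι) from Set.Subset.antisymm hI h, reflectionSubgroup_support]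
      exact Subgroup.map_top_of_surjective _ (MulAut.conj w).surjective
    obtain ⟨j, hj, hjI⟩ := hIne
    refine ⟨weylRep P w (fundamentalCoweight b j), fun h0 => ?_, fun u hu => ?_⟩
    · have h1 := congrArg (weylRep P w⁻¹) h0
      rw [weylRep_inv_apply, map_zero] at h1
      have h2 := rootEval_fundamentalCoweight b j j
      rw [h1, map_zero, coef_simple_self b hj] at h2
      norm_num at h2
    · obtain ⟨u', hu', rfl⟩ := hle hu
      change weylRep P (w * u' * w⁻¹) _ = _
      rw [weylRep_mul_apply, weylRep_inv_apply, weylRep_mul_apply]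
      congr 1
      refine weylRep_eq_self_of_mem_reflectionSubgroup (fun i hi => ?_) hu'
      rw [rootEval_fundamentalCoweight, coef_simple_of_ne b (hI hi), Int.cast_zero]
      rintro rfl
      exact hjI hi
  · rintro ⟨x, hx0, hx⟩
    obtain ⟨d, hd⟩ := exists_rootEval_eq b (P := P) fun _ => 1
    obtain ⟨w, -, hw⟩ := exists_weylRep_nonneg (I := (b.support : Set ι)) (H := ⊤)
      (fun _ _ => trivial) (d := d) (fun i hi => by rw [hd i hi]; norm_num) x
    set I : Set ι := {j | j ∈ b.support ∧ rootEval P j (weylRep P w x) = 0} with hI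
    refine ⟨_, ⟨I, fun j hj => hj.1, w⁻¹, rfl⟩, fun htop => ?_, fun u hu => ?_⟩
    · have htop' : reflectionSubgroup P I = ⊤ := by
        apply Subgroup.map_injective (f := (MulAut.conj w⁻¹).toMonoidHom) (MulAut.conj w⁻¹).injective
        rw [htop]
        exact (Subgroup.map_top_of_surjective _ (MulAut.conj w⁻¹).surjective).symm
      apply hx0
      have h1 : weylRep P w x = 0 := by
        apply eq_zero_of_rootEval P b
        intro i hi
        rw [← weylRep_ofIdx_eq_self_iff]
        apply weylRep_eq_self_of_mem_reflectionSubgroup (S := I) fun j hj => hj.2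
        rw [htop']
        trivial
      rw [← weylRep_inv_apply w x, h1, map_zero]
    · refine ⟨w * u * w⁻¹, ?_, ?_⟩
      · apply mem_reflectionSubgroup_of_dominant b hw
        rw [weylRep_mul_apply, weylRep_inv_apply, weylRep_mul_apply, hx u hu]
        exact hw
      · change w⁻¹ * (w * u * w⁻¹) * w⁻¹⁻¹ = u
        group

end Parabolic

/-! ### Levels and an intrinsic description of the extended set of simple roots -/

section Level

variable {ι X Y : Type*} [AddCommGroup X] [AddCommGroup Y] {P : RootDatum ι X Y} (b : P.Base)

open Classical in
/-- The integer part of a root on the interior of the fundamental alcove: `0` for positive roots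
and `-1` for negative roots. -/
def level (i : ι) : ℤ := if b.IsPos i then 0 else -1

theorem level_of_isPos {i : ι} (hi : b.IsPos i) : level b i = 0 := if_pos hi

theorem level_of_not_isPos {i : ι} (hi : ¬ b.IsPos i) : level b i = -1 := if_neg hi

theorem level_nonpos (i : ι) : level b i ≤ 0 := by
  by_cases hi : b.IsPos i
  · rw [level_of_isPos b hi]
  · rw [level_of_not_isPos b hi]; norm_num

theorem isPos_of_sum_level_eq_zero {s : Multiset ι} (h : (s.map (level b)).sum = 0) {j : ι}
    (hj : j ∈ s) : b.IsPos j := by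
  obtain ⟨t, rfl⟩ := Multiset.exists_cons_of_mem hj
  rw [Multiset.map_cons, Multiset.sum_cons] at h
  have h1 : (t.map (level b)).sum ≤ 0 := by
    refine Multiset.sum_induction (fun x => x ≤ 0) _ (fun x y hx hy => add_nonpos hx hy) le_rfl ?_
    intro x hx
    obtain ⟨k, -, rfl⟩ := Multiset.mem_map.mp hx
    exact level_nonpos b k
  by_contra hn
  rw [level_of_not_isPos b hn] at h
  omega

theorem sum_level_eq_zero {s : Multiset ι} (h : ∀ j ∈ s, b.IsPos j) :
    (s.map (level b)).sum = 0 := by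
  apply Multiset.sum_eq_zero
  intro x hx
  obtain ⟨k, hk, rfl⟩ := Multiset.mem_map.mp hx
  exact level_of_isPos b (h k hk)

theorem coef_eq_sum_map {i : ι} {s : Multiset ι} (h : P.root i = (s.map P.root).sum) (l : ι) :
    coef b l i = (s.map (coef b l)).sum := by
  by_cases hl : l ∈ b.support
  · refine coef_eq_of_root_eq b (f := fun l => (s.map (coef b l)).sum) ?_ hl
    rw [h]
    clear h
    induction s using Multiset.induction_on with
    | empty => simp
    | cons j s ih =>
      simp only [Multiset.map_cons, Multiset.sum_cons, add_smul, Finset.sum_add_distrib]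
      rw [← root_eq_sum_coef, ih]
  · rw [coef_of_notMem b hl, eq_comm]
    apply Multiset.sum_eq_zero
    intro x hx
    obtain ⟨k, -, rfl⟩ := Multiset.mem_map.mp hx
    exact coef_of_notMem b hl k

theorem height_eq_sum_map {i : ι} {s : Multiset ι} (h : P.root i = (s.map P.root).sum) :
    b.height i = (s.map b.height).sum := by
  rw [height_eq_sum_coef, Finset.sum_congr rfl fun l _ => coef_eq_sum_map b h l]
  clear h
  induction s using Multiset.induction_on with
  | empty => simp
  | cons j s ih =>
    simp only [Multiset.map_cons, Multiset.sum_cons, Finset.sum_add_distrib]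
    rw [ih, height_eq_sum_coef]

theorem card_le_sum_height {s : Multiset ι} (h : ∀ j ∈ s, b.IsPos j) :
    (s.card : ℤ) ≤ (s.map b.height).sum := by
  induction s using Multiset.induction_on with
  | empty => simp
  | cons j s ih =>
    rw [Multiset.map_cons, Multiset.sum_cons, Multiset.card_cons]
    have h1 := ih fun k hk => h k (Multiset.mem_cons_of_mem hk)
    have h2 := (b.isPos_iff).mp (h j (Multiset.mem_cons_self j s))
    push_cast
    omega

theorem exists_multiset_simple {f : ι → ℤ} (hf : ∀ j, 0 ≤ f j) :
    ∃ s : Multiset ι, (∀ j ∈ s, j ∈ b.support) ∧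
      (s.map P.root).sum = ∑ j ∈ b.support, f j • P.root j := by
  refine ⟨∑ j ∈ b.support, (f j).toNat • {j}, fun j hj => ?_, ?_⟩
  · obtain ⟨k, hk, hjk⟩ := Multiset.mem_sum.mp hj
    rw [Multiset.mem_singleton.mp (Multiset.mem_of_mem_nsmul hjk)]
    exact hk
  · have : ∀ t : Finset ι, ((∑ j ∈ t, (f j).toNat • ({j} : Multiset ι)).map P.root).sum =
        ∑ j ∈ t, f j • P.root j := by
      classical
      intro t
      induction t using Finset.induction_on with
      | empty => simp
      | insert j t hj ih =>
        rw [Finset.sum_insert hj, Finset.sum_insert hj, Multiset.map_add, Multiset.sum_add, ih,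
          Multiset.map_nsmul, Multiset.sum_nsmul, Multiset.map_singleton, Multiset.sum_singleton,
          ← natCast_zsmul, Int.toNat_of_nonneg (hf j)]
    exact this _

variable [Finite ι]

theorem shift_eq_level {i : ι} (hi : i ∈ extSimple b) : shift b i = level b i := by
  rcases (mem_extSimple_iff b).mp hi with h | h
  · rw [shift_of_mem b h, level_of_isPos b (RootPairing.Base.isPos_of_mem_support h)]
  · have h1 : i ∉ b.support := h ▸ negHighestRoot_notMem b _
    have h2 : ¬ b.IsPos i := h ▸ not_isPos_negHighestRoot b _
    rw [shift_of_notMem b h1, level_of_not_isPos b h2]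

theorem exists_simple_of_component (c : Component P) : ∃ l ∈ b.support, comp P l = c := by
  obtain ⟨l, hl, hl0⟩ := exists_coef_ne_zero b (highestRoot b c)
  exact ⟨l, hl, (comp_eq_of_coef_ne_zero b hl0).trans (comp_highestRoot b c)⟩

/-- The elements of `Δ̃` are the roots that are indecomposable when levels are taken into account:
they correspond to the simple affine roots. -/
theorem mem_extSimple_iff_indecomposable (i : ι) :
    i ∈ extSimple b ↔ ∀ s : Multiset ι, P.root i = (s.map P.root).sum →
      level b i = (s.map (level b)).sum → s.card = 1 := by
  constructor
  · intro hi s hs hl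
    have hne : s.card ≠ 0 := by
      intro h0
      rw [Multiset.card_eq_zero] at h0
      rw [h0] at hs
      exact P.ne_zero i (by simpa using hs)
    rcases (mem_extSimple_iff b).mp hi with h | h
    · rw [level_of_isPos b (RootPairing.Base.isPos_of_mem_support h)] at hl
      have h1 := card_le_sum_height b fun j hj => isPos_of_sum_level_eq_zero b hl.symm hj
      rw [← height_eq_sum_map b hs, RootPairing.Base.height_one_of_mem_support h] at h1
      omega
    · have hneg : ¬ b.IsPos i := h ▸ not_isPos_negHighestRoot b _
      rw [level_of_not_isPos b hneg] at hl
      obtain ⟨j, hj, hjneg⟩ : ∃ j ∈ s, ¬ b.IsPos j := by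
        by_contra! hall
        rw [sum_level_eq_zero b hall] at hl
        omega
      obtain ⟨t, rfl⟩ := Multiset.exists_cons_of_mem hj
      rw [Multiset.map_cons, Multiset.sum_cons, level_of_not_isPos b hjneg] at hl
      have htpos : ∀ k ∈ t, b.IsPos k := fun k hk =>
        isPos_of_sum_level_eq_zero b (by omega) hk
      have hcomp : comp P j = comp P i := by
        obtain ⟨l, hl, hlc⟩ := exists_simple_of_component b (comp P i)
        have h1 := coef_eq_sum_map b hs l
        rw [Multiset.map_cons, Multiset.sum_cons] at h1
        have h2 : 0 ≤ (t.map (coef b l)).sum := by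
          apply Multiset.sum_nonneg
          intro x hx
          obtain ⟨k, hk, rfl⟩ := Multiset.mem_map.mp hx
          exact (isPos_iff_coef b k).mp (htpos k hk) l
        have h3 : coef b l i < 0 := by
          rw [h, coef_negHighestRoot, neg_neg_iff_pos]
          exact coef_highestRoot_pos b hl hlc
        rw [← comp_eq_of_coef_ne_zero b (show coef b l j ≠ 0 by omega), hlc]
      have h1 := height_eq_sum_map b hs
      rw [Multiset.map_cons, Multiset.sum_cons] at h1
      have h2 := card_le_sum_height b htpos
      have h3 := (highestRoot_spec b (comp P i)).2 (P.reflectionPerm j j)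
        (by rw [comp_neg, hcomp])
      have h4 : b.height (P.reflectionPerm j j) = -b.height j := b.height_reflectionPerm_self j
      have h5 : b.height i = -b.height (highestRoot b (comp P i)) := by
        nth_rewrite 1 [h]
        exact b.height_reflectionPerm_self _
      rw [Multiset.card_cons]
      omega
  · intro h
    rw [mem_extSimple_iff]
    by_cases hi : b.IsPos i
    · left
      obtain ⟨s, hs, hsum⟩ := exists_multiset_simple b ((isPos_iff_coef b i).mp hi)
      rw [← root_eq_sum_coef] at hsum
      obtain ⟨j, rfl⟩ := Multiset.card_eq_one.mp (h s hsum.symm (by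
        rw [level_of_isPos b hi, sum_level_eq_zero b fun j hj =>
          RootPairing.Base.isPos_of_mem_support (hs j hj)]))
      rw [Multiset.map_singleton, Multiset.sum_singleton] at hsum
      rw [← P.root.injective hsum]
      exact hs j (Multiset.mem_singleton_self j)
    · right
      set c := comp P i with hc
      obtain ⟨s, hs, hsum⟩ := exists_multiset_simple b
        (f := fun j => coef b j (highestRoot b c) + coef b j i) fun j => by
          have := coef_le_coef_highestRoot b c (i := P.reflectionPerm i i) (comp_neg i) j
          rw [coef_neg] at this
          omega
      simp only [add_smul, Finset.sum_add_distrib, ← root_eq_sum_coef] at hsum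
      have hcard := h (negHighestRoot b c ::ₘ s)
        (by rw [Multiset.map_cons, Multiset.sum_cons, hsum, root_negHighestRoot]; abel)
        (by rw [Multiset.map_cons, Multiset.sum_cons, level_of_not_isPos b hi,
              level_of_not_isPos b (not_isPos_negHighestRoot b c),
              sum_level_eq_zero b fun j hj => RootPairing.Base.isPos_of_mem_support (hs j hj),
              add_zero])
      rw [Multiset.card_cons, Nat.add_eq_right, Multiset.card_eq_zero] at hcard
      rw [hcard, Multiset.map_zero, Multiset.sum_zero] at hsum
      apply P.root.injective
      rw [root_negHighestRoot]
      exact (neg_eq_of_add_eq_zero_right hsum.symm).symm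

omit [Finite ι] in
theorem smul_sum_map_root (w : P.weylGroup) (s : Multiset ι) :
    w • (s.map P.root).sum = ((s.map (w • ·)).map P.root).sum := by
  induction s using Multiset.induction_on with
  | empty => simp
  | cons j s ih =>
    simp only [Multiset.map_cons, Multiset.sum_cons, smul_add, ih, root_smul]

omit [Finite ι] in
theorem evalHom_sum_map (v : V Y) (s : Multiset ι) :
    evalHom P v (s.map P.root).sum = (s.map fun j => rootEval P j v).sum := by
  rw [map_multiset_sum, Multiset.map_map]
  rfl

/-- If `w`, followed by a translation by `y`, permutes the affine roots that are positive on the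
fundamental alcove, then `w` preserves `Δ̃`. -/
theorem smul_mem_extSimple_of_level {w : P.weylGroup} {y : V Y}
    (h : ∀ i, (level b (w • i) : ℚ) = level b i + rootEval P (w • i) y) {i : ι}
    (hi : i ∈ extSimple b) : w • i ∈ extSimple b := by
  rw [mem_extSimple_iff_indecomposable] at hi ⊢
  intro s hs hl
  have h1 : P.root i = ((s.map (w⁻¹ • ·)).map P.root).sum := by
    rw [← smul_sum_map_root, ← hs, ← root_smul, inv_smul_smul]
  have h2 : level b i = ((s.map (w⁻¹ • ·)).map (level b)).sum := by
    have hlev : ∀ j, (level b (w⁻¹ • j) : ℚ) = level b j - rootEval P j y := fun j => by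
      have := h (w⁻¹ • j)
      rw [smul_inv_smul] at this
      linarith
    have h3 : (((s.map (w⁻¹ • ·)).map (level b)).sum : ℚ) =
        ((s.map (level b)).sum : ℚ) - (s.map fun j => rootEval P j y).sum := by
      clear hs hl h1
      induction s using Multiset.induction_on with
      | empty => simp
      | cons j s ih =>
        simp only [Multiset.map_cons, Multiset.sum_cons, Int.cast_add] at ih ⊢
        rw [ih, hlev]
        ring
    have h4 : (level b i : ℚ) = ((s.map (w⁻¹ • ·)).map (level b)).sum := by
      rw [h3, ← hl, ← evalHom_sum_map, ← hs, evalHom_root, h i]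
      ring
    exact_mod_cast h4
  simpa using hi _ h1 h2

omit [AddCommGroup X] [AddCommGroup Y] in
theorem smul_set_eq_of_forall_mem {G : Type*} [Group G] [MulAction G ι] {g : G} {S : Set ι}
    (h : ∀ i ∈ S, g • i ∈ S) : g • S = S := by
  refine Set.eq_of_subset_of_ncard_le ?_ ?_ (Set.toFinite S)
  · rintro _ ⟨i, hi, rfl⟩
    exact h i hi
  · exact (Set.ncard_image_of_injective S (MulAction.injective g)).ge

end Level

/-! ### Elements of the Weyl group preserving `Δ̃` -/

section Diagram

variable {ι X Y : Type*} [Finite ι] [AddCommGroup X] [AddCommGroup Y] {P : RootDatum ι X Y}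
  {b : P.Base}

theorem smul_mem_of_mem_diagramGroup {z : P.weylGroup} (hz : z ∈ diagramGroup b) {i : ι} :
    z • i ∈ extSimple b ↔ i ∈ extSimple b := by
  have h : z • extSimple b = extSimple b := hz
  nth_rewrite 1 [← h]
  exact Set.smul_mem_smul_set_iff

theorem smul_mem_extSimpleRoots_iff {z : P.weylGroup} (hz : z ∈ diagramGroup b) {c : Component P}
    {i : ι} : z • i ∈ extSimpleRoots b c ↔ i ∈ extSimpleRoots b c := by
  rw [mem_extSimpleRoots_iff', mem_extSimpleRoots_iff', smul_mem_of_mem_diagramGroup hz, comp_smul]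

/-- The marks are invariant under `𝒜`, since up to scaling they give the only linear relation
between the elements of `Δ̃_c`. -/
theorem mark_smul {z : P.weylGroup} (hz : z ∈ diagramGroup b) {i : ι} (hi : i ∈ extSimple b) :
    mark b (z • i) = mark b i := by
  classical
  set c := comp P i with hc
  set n := negHighestRoot b c with hn
  have hrel : ∀ j, ∑ k ∈ extFinset b c, mark b (z⁻¹ • k) * coef b j k = 0 := by
    intro j
    have h1 : ∑ k ∈ extFinset b c, mark b (z⁻¹ • k) * coef b j k =
        ∑ k ∈ extFinset b c, mark b k * coef b j (z • k) := by
      refine Finset.sum_bij' (fun k _ => z⁻¹ • k) (fun k _ => z • k) ?_ ?_ ?_ ?_ ?_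
      · intro k hk
        rw [mem_extFinset] at hk ⊢
        exact (smul_mem_extSimpleRoots_iff (inv_mem hz)).mpr hk
      · intro k hk
        rw [mem_extFinset] at hk ⊢
        exact (smul_mem_extSimpleRoots_iff hz).mpr hk
      · intro k _
        exact smul_inv_smul z k
      · intro k _
        exact inv_smul_smul z k
      · intro k _
        rw [smul_inv_smul]
    rw [h1]
    rw [Finset.sum_congr rfl fun k _ => by rw [coef_smul_eq_sum b z k j, Finset.mul_sum],
      Finset.sum_comm]
    refine Finset.sum_eq_zero fun l _ => ?_
    simp only [← mul_assoc]
    rw [← Finset.sum_mul, sum_extFinset_mark_coef, zero_mul]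
  have hprop : ∀ j ∈ extSimpleRoots b c, mark b (z⁻¹ • j) = mark b (z⁻¹ • n) * mark b j := by
    intro j hj
    rcases (mem_extSimpleRoots_iff b).mp hj with ⟨hj1, hj2⟩ | rfl
    · have hjn : n ≠ j := fun h => negHighestRoot_notMem b c (hn ▸ h ▸ hj1)
      have h1 := hrel j
      rw [← Finset.sum_subset (s₁ := {n, j}), Finset.sum_pair hjn, coef_simple_self b hj1, hn,
        coef_negHighestRoot] at h1
      · rw [mark_of_mem b hj1, hj2, hn]
        linarith
      · intro k hk
        rw [Finset.mem_insert, Finset.mem_singleton] at hk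
        rw [mem_extFinset]
        rcases hk with rfl | rfl
        · exact negHighestRoot_mem_extSimpleRoots b c
        · exact hj
      · intro k hk hk'
        rw [Finset.mem_insert, Finset.mem_singleton, not_or] at hk'
        rw [mem_extFinset, mem_extSimpleRoots_iff] at hk
        rw [coef_simple_of_ne b (hk.resolve_right hk'.1).1 (Ne.symm hk'.2), mul_zero]
    · rw [mark_of_notMem b (negHighestRoot_notMem b c), mul_one]
  have hq : mark b (z⁻¹ • n) = 1 := by
    have h1 := hprop (z • n) ((smul_mem_extSimpleRoots_iff hz).mpr
      (negHighestRoot_mem_extSimpleRoots b c))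
    rw [inv_smul_smul, hn, mark_of_notMem b (negHighestRoot_notMem b c)] at h1
    rcases Int.eq_one_or_neg_one_of_mul_eq_one h1.symm with h2 | h2
    · exact h2
    · have := mark_pos b (z⁻¹ • negHighestRoot b c)
      omega
  have h1 := hprop (z • i) ((smul_mem_extSimpleRoots_iff hz).mpr
    ((mem_extSimpleRoots_iff' b).mpr ⟨hi, rfl⟩))
  rw [inv_smul_smul, hq, one_mul] at h1
  exact h1.symm

/-- The level of `z⁻¹ α` for `z ∈ 𝒜` and `α ∈ Δ̃` differs from that of `α` by the value of `α` at
the fundamental coweight `ϖ^∨(z)`. -/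
theorem rootEval_sum_fundamentalCoweight [Module.Free ℤ X] [Module.Finite ℤ X]
    [Module.Free ℤ Y] [Module.Finite ℤ Y] [IsSemisimple P] {z : P.weylGroup}
    (hz : z ∈ diagramGroup b) {i : ι} (hi : i ∈ extSimple b) :
    rootEval P i (∑ᶠ c, fundamentalCoweight b (z • negHighestRoot b c)) =
      shift b i - shift b (z⁻¹ • i) := by
  classical
  let := Fintype.ofFinite (Component P)
  set c := comp P i with hc
  set a := z • negHighestRoot b c with ha
  have haC : comp P a = c := by rw [ha, comp_smul, comp_negHighestRoot]
  have ha' : a ∈ extSimple b :=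
    (smul_mem_of_mem_diagramGroup hz).mpr (negHighestRoot_mem b c)
  have h1 : rootEval P i (∑ᶠ c, fundamentalCoweight b (z • negHighestRoot b c)) =
      coef b a i := by
    rw [finsum_eq_sum_of_fintype, map_sum, Finset.sum_eq_single c]
    · rw [rootEval_fundamentalCoweight]
    · intro d _ hd
      rw [rootEval_fundamentalCoweight, coef_eq_zero_of_comp_ne, Int.cast_zero]
      rw [comp_smul, comp_negHighestRoot]
      exact hd
    · intro h
      exact absurd (Finset.mem_univ c) h
  have hinv : z⁻¹ • i ∈ b.support ↔ i ≠ a := by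
    have h2 := (mem_extSimple_iff b).mp ((smul_mem_of_mem_diagramGroup (inv_mem hz)).mpr hi)
    rw [comp_smul, ← hc] at h2
    constructor
    · intro h h'
      rw [h', ha, inv_smul_smul] at h
      exact negHighestRoot_notMem b c h
    · intro h
      refine h2.resolve_right fun h3 => h ?_
      rw [ha, ← h3, smul_inv_smul]
  have hshift : shift b (z⁻¹ • i) = if i = a then -1 else 0 := by
    split_ifs with h
    · exact shift_of_notMem b fun h' => hinv.mp h' h
    · exact shift_of_mem b (hinv.mpr h)
  have hcoef : coef b a i = shift b i - shift b (z⁻¹ • i) := by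
    rw [hshift]
    rcases (mem_extSimple_iff b).mp hi with h | h
    · rw [shift_of_mem b h]
      split_ifs with hia
      · rw [← hia, coef_simple_self b h]; norm_num
      · rw [coef_simple_of_ne b h (Ne.symm hia)]; norm_num
    · have hn : i ∉ b.support := h ▸ negHighestRoot_notMem b _
      rw [shift_of_notMem b hn]
      split_ifs with hia
      · rw [← hia, coef_of_notMem b hn]; norm_num
      · have hsa : a ∈ b.support := by
          refine ((mem_extSimple_iff b).mp ha').resolve_right fun h' => hia ?_
          rw [h', haC]
          exact h
        have hmark : mark b a = 1 := by
          rw [ha, mark_smul hz (negHighestRoot_mem b c),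
            mark_of_notMem b (negHighestRoot_notMem b c)]
        rw [mark_of_mem b hsa, haC] at hmark
        rw [h, coef_negHighestRoot, ← hc, hmark]
        norm_num
  rw [h1, hcoef]
  push_cast
  ring

end Diagram

/-! ### Longest elements of parabolic subgroups -/

section Longest

variable {ι X Y : Type*} [AddCommGroup X] [AddCommGroup Y] {P : RootDatum ι X Y} {b : P.Base}

theorem mem_parabolicRoots_iff {c : Component P} {i j : ι} :
    j ∈ parabolicRoots b c i ↔
      ∀ l, coef b l j ≠ 0 → l ∈ b.support ∧ comp P l = c ∧ l ≠ i := by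
  classical
  constructor
  · intro h l hl
    have key : ∀ x ∈ Submodule.span ℤ (P.root '' (simpleRoots b c \ {i})), ∃ f : ι → ℤ,
        x = ∑ j ∈ b.support, f j • P.root j ∧ ∀ l, f l ≠ 0 → l ∈ simpleRoots b c \ {i} := by
      intro x hx
      induction hx using Submodule.span_induction with
      | mem x hx =>
        obtain ⟨k, hk, rfl⟩ := hx
        refine ⟨fun l => if l = k then 1 else 0, ?_, fun l hl => ?_⟩
        · have : k ∈ b.support := hk.1.1
          simp [ite_smul, this]
        · rw [show l = k by by_contra h; exact hl (if_neg h)]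
          exact hk
      | zero => exact ⟨0, by simp, fun l hl => absurd rfl hl⟩
      | add x y _ _ hx hy =>
        obtain ⟨f, rfl, hf⟩ := hx
        obtain ⟨g, rfl, hg⟩ := hy
        refine ⟨f + g, by simp [add_smul, Finset.sum_add_distrib], fun l hl => ?_⟩
        by_cases h0 : f l = 0
        · exact hg l fun h1 => hl (by simp [h0, h1])
        · exact hf l h0
      | smul n x _ hx =>
        obtain ⟨f, rfl, hf⟩ := hx
        refine ⟨n • f, by simp [Finset.smul_sum, mul_smul], fun l hl => hf l fun h0 => hl ?_⟩
        simp [h0]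
    obtain ⟨f, hf, hf'⟩ := key (P.root j) h
    have hls : l ∈ b.support := by
      by_contra hls
      exact hl (coef_of_notMem b hls j)
    rw [coef_eq_of_root_eq b hf hls] at hl
    exact ⟨hls, (hf' l hl).1.2, (hf' l hl).2⟩
  · intro h
    change P.root j ∈ Submodule.span ℤ (P.root '' (simpleRoots b c \ {i}))
    rw [root_eq_sum_coef b j]
    refine Submodule.sum_mem _ fun l hl => ?_
    by_cases h0 : coef b l j = 0
    · rw [h0, zero_smul]
      exact Submodule.zero_mem _
    · obtain ⟨h1, h2, h3⟩ := h l h0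
      exact Submodule.smul_mem _ _ (Submodule.subset_span (Set.mem_image_of_mem _ ⟨⟨h1, h2⟩, h3⟩))

theorem neg_mem_parabolicRoots {c : Component P} {i j : ι} (h : j ∈ parabolicRoots b c i) :
    P.reflectionPerm j j ∈ parabolicRoots b c i := by
  rw [mem_parabolicRoots_iff] at h ⊢
  intro l hl
  rw [coef_neg, neg_ne_zero] at hl
  exact h l hl

theorem simple_mem_parabolicRoots {c : Component P} {i j : ι} (hj : j ∈ b.support)
    (hc : comp P j = c) (hi : j ≠ i) : j ∈ parabolicRoots b c i := by
  rw [mem_parabolicRoots_iff]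
  intro l hl
  have : l = j := by
    by_contra h
    exact hl (coef_simple_of_ne b hj h)
  subst this
  exact ⟨hj, hc, hi⟩

/-- The reflections in `Φ_i` only change the coefficients of the simple roots of `Φ_i`. -/
theorem coef_smul_of_mem_reflectionSubgroup {c : Component P} {i l : ι}
    (hl : ¬ (l ∈ b.support ∧ comp P l = c ∧ l ≠ i)) {w : P.weylGroup}
    (hw : w ∈ reflectionSubgroup P (parabolicRoots b c i)) (j : ι) :
    coef b l (w • j) = coef b l j := by
  induction hw using Subgroup.closure_induction generalizing j with
  | mem u hu =>
    obtain ⟨k, hk, rfl⟩ := hu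
    have h0 : coef b l k = 0 := by
      by_contra h
      exact hl (mem_parabolicRoots_iff.mp hk l h)
    rw [ofIdx_smul_eq, coef_reflectionPerm, h0, mul_zero, sub_zero]
  | one => rw [one_smul]
  | mul u u' _ _ hu hu' => rw [mul_smul, hu, hu']
  | inv u _ hu => rw [← hu, smul_inv_smul]

theorem smul_mem_parabolicRoots {c : Component P} {i j : ι} {w : P.weylGroup}
    (hw : w ∈ reflectionSubgroup P (parabolicRoots b c i)) (hj : j ∈ parabolicRoots b c i) :
    w • j ∈ parabolicRoots b c i := by
  rw [mem_parabolicRoots_iff] at hj ⊢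
  intro l hl
  by_contra h
  rw [coef_smul_of_mem_reflectionSubgroup h hw] at hl
  exact h (hj l hl)

theorem IsLongest.not_isPos_smul {c : Component P} {i j : ι} {w : P.weylGroup}
    (hw : IsLongest b c i w) (hj : j ∈ parabolicRoots b c i) (hpos : b.IsPos j) :
    ¬ b.IsPos (w • j) := by
  have h : w • j ∈ w • {j ∈ parabolicRoots b c i | b.IsPos j} :=
    Set.smul_mem_smul_set ⟨hj, hpos⟩
  rw [hw.2] at h
  exact h.2

theorem IsLongest.isPos_inv_smul {c : Component P} {i j : ι} {w : P.weylGroup}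
    (hw : IsLongest b c i w) (hj : j ∈ parabolicRoots b c i) (hneg : ¬ b.IsPos j) :
    b.IsPos (w⁻¹ • j) := by
  have h : j ∈ w • {j ∈ parabolicRoots b c i | b.IsPos j} := by
    rw [hw.2]
    exact ⟨hj, hneg⟩
  exact (Set.mem_smul_set_iff_inv_smul_mem.mp h).2

theorem IsLongest.not_isPos_inv_smul {c : Component P} {i j : ι} {w : P.weylGroup}
    (hw : IsLongest b c i w) (hj : j ∈ parabolicRoots b c i) (hpos : b.IsPos j) :
    ¬ b.IsPos (w⁻¹ • j) := by
  have h := hw.isPos_inv_smul (neg_mem_parabolicRoots hj) (by rwa [isPos_neg_iff, not_not])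
  rwa [smul_neg_idx, isPos_neg_iff] at h

variable [Finite ι] [Module.Free ℤ X] [Module.Finite ℤ X] [Module.Free ℤ Y] [Module.Finite ℤ Y]
  [IsSemisimple P]

variable (b) in
theorem exists_isLongest (c : Component P) (i : ι) : ∃ w : P.weylGroup, IsLongest b c i w := by
  obtain ⟨d, hd⟩ := exists_rootEval_eq b (P := P) fun _ => 1
  have hdpos : ∀ j, b.IsPos j → 0 < rootEval P j d := by
    intro j hj
    rw [rootEval_eq_height_mul b hd, mul_one]
    exact_mod_cast (b.isPos_iff).mp hj
  obtain ⟨h, hh, hnn⟩ := exists_weylRep_nonneg (I := simpleRoots b c \ {i})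
    (H := reflectionSubgroup P (parabolicRoots b c i))
    (fun j hj => ofIdx_mem_reflectionSubgroup (simple_mem_parabolicRoots hj.1.1 hj.1.2 hj.2))
    (d := d) (fun j hj => hdpos j (RootPairing.Base.isPos_of_mem_support hj.1.1)) (-d)
  have hw := inv_mem hh
  have key : ∀ j ∈ parabolicRoots b c i, b.IsPos j → ¬ b.IsPos (h⁻¹ • j) := by
    intro j hj hjpos
    apply not_isPos_smul_of_forall b hjpos
    intro l hl hl0 hlpos
    obtain ⟨h1, h2, h3⟩ := mem_parabolicRoots_iff.mp hj l hl0
    have h4 := hnn l ⟨⟨h1, h2⟩, h3⟩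
    rw [rootEval_weylRep, map_neg] at h4
    linarith [hdpos _ hlpos]
  refine ⟨h⁻¹, hw, Set.Subset.antisymm ?_ ?_⟩
  · rintro _ ⟨j, ⟨hj, hjpos⟩, rfl⟩
    exact ⟨smul_mem_parabolicRoots hw hj, key j hj hjpos⟩
  · rintro j ⟨hj, hjneg⟩
    have h1 : h⁻¹⁻¹ • j ∈ parabolicRoots b c i := smul_mem_parabolicRoots (inv_mem hw) hj
    refine Set.mem_smul_set_iff_inv_smul_mem.mpr ⟨h1, ?_⟩
    by_contra h2
    rw [← isPos_neg_iff] at h2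
    have h3 := key _ (neg_mem_parabolicRoots h1) h2
    rw [smul_neg_idx, smul_inv_smul, isPos_neg_iff, not_not] at h3
    exact hjneg h3

omit [Module.Free ℤ X] [Module.Finite ℤ X] [Module.Free ℤ Y] [Module.Finite ℤ Y]
  [IsSemisimple P] in
/-- For `α ∈ Δ̃_c` with `n_α = 1`, the element `w_α` maps the highest root to `α`: it reverses the
order of the roots with the same coefficient of `α`, of which `α` is the lowest. -/
theorem IsLongest.smul_highestRoot {c : Component P} {i : ι} (hi : i ∈ minusculeRoots b c)
    {w : P.weylGroup} (hw : IsLongest b c i w) : w • highestRoot b c = i := by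
  obtain ⟨hi1, hmark⟩ := hi
  have hic := comp_of_mem_extSimpleRoots b hi1
  set θ := highestRoot b c with hθ
  have hγc : comp P (w⁻¹ • i) = c := by rw [comp_smul, hic]
  have hle : ∀ m, coef b m (w • θ) ≤ coef b m i := by
    intro m
    have h1 := coef_smul_eq_sum b w (w⁻¹ • i) m
    rw [smul_inv_smul] at h1
    rw [h1, coef_smul_eq_sum b w θ m]
    refine Finset.sum_le_sum fun l hl => ?_
    by_cases hlc : comp P l = c
    · by_cases hli : l = i
      · have h2 : coef b l (w⁻¹ • i) = 1 := by
          rw [coef_smul_of_mem_reflectionSubgroup (fun h => h.2.2 hli) (inv_mem hw.1), hli,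
            coef_simple_self b (hli ▸ hl)]
        have h3 : coef b l θ = 1 := by
          rw [← hli, mark_of_mem b hl, hlc] at hmark
          exact hmark
        rw [h2, h3]
      · refine mul_le_mul_of_nonpos_right (coef_le_coef_highestRoot b c hγc l) ?_
        exact (not_isPos_iff_coef b _).mp (hw.not_isPos_smul (simple_mem_parabolicRoots hl hlc hli)
          (RootPairing.Base.isPos_of_mem_support hl)) m
    · have h2 : coef b l (w⁻¹ • i) = 0 := coef_eq_zero_of_comp_ne b (by rwa [hγc])
      have h3 : coef b l θ = 0 := coef_eq_zero_of_comp_ne b (by rwa [hθ, comp_highestRoot])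
      rw [h2, h3]
  rcases (mem_extSimpleRoots_iff b).mp hi1 with ⟨h1, -⟩ | h1
  · have h2 : coef b i (w • θ) = 1 := by
      rw [coef_smul_of_mem_reflectionSubgroup (fun h => h.2.2 rfl) hw.1]
      rw [mark_of_mem b h1, hic] at hmark
      exact hmark
    have hpos : b.IsPos (w • θ) := isPos_of_coef_pos b (j := i) (by rw [h2]; norm_num)
    apply P.root.injective
    rw [root_eq_sum_coef b (w • θ), root_eq_sum_coef b i]
    refine Finset.sum_congr rfl fun m _ => ?_
    by_cases hm : m = i
    · rw [hm, h2, coef_simple_self b h1]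
    · have h3 := hle m
      rw [coef_simple_of_ne b h1 hm] at h3
      rw [coef_simple_of_ne b h1 hm, le_antisymm h3 ((isPos_iff_coef b _).mp hpos m)]
  · have h2 : P.reflectionPerm (w • θ) (w • θ) = θ := by
      apply eq_highestRoot_of_coef_le b
      · rw [comp_neg, comp_smul, hθ, comp_highestRoot]
      · intro j _
        have h3 := hle j
        rw [h1, coef_negHighestRoot] at h3
        rw [coef_neg]
        omega
    apply P.root.injective
    rw [h1, root_negHighestRoot, ← hθ, ← h2, RootPairing.root_reflectionPerm,
      RootPairing.reflection_apply_self, neg_neg, h2]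

omit [Module.Free ℤ X] [Module.Finite ℤ X] [Module.Free ℤ Y] [Module.Finite ℤ Y]
  [IsSemisimple P] in
theorem negHighestRoot_mem_minusculeRoots (c : Component P) :
    negHighestRoot b c ∈ minusculeRoots b c :=
  ⟨negHighestRoot_mem_extSimpleRoots b c, mark_of_notMem b (negHighestRoot_notMem b c)⟩

omit [Module.Free ℤ X] [Module.Finite ℤ X] [Module.Free ℤ Y] [Module.Finite ℤ Y]
  [IsSemisimple P] in
/-- The element `z_α` maps `-α̃_c` to `α`. -/
theorem HasComponent.smul_negHighestRoot {c : Component P} {i : ι} (hi : i ∈ minusculeRoots b c)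
    {z : P.weylGroup} (hz : HasComponent b c i z) : z • negHighestRoot b c = i := by
  obtain ⟨w, w₀, hw, hw₀, h⟩ := hz
  have h1 := hw₀.smul_highestRoot (negHighestRoot_mem_minusculeRoots c)
  have h2 : w₀ • negHighestRoot b c = highestRoot b c := by
    apply P.root.injective
    have h3 : P.root (w₀ • negHighestRoot b c) =
        -P.root (w₀ • highestRoot b c) := by
      rw [root_smul, root_negHighestRoot, smul_neg, root_smul]
    rw [h3, h1, root_negHighestRoot, neg_neg]
  rw [h _ (comp_negHighestRoot b c), mul_smul, h2, hw.smul_highestRoot hi]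

/-- An element `z` of `𝒜` acts on `Φ_c` as `z_α`, where `α = z(-α̃_c)`. Indeed `w_α⁻¹ z` makes all
the simple roots of `Φ_c` negative, so that it acts as the longest element of `W_c`. -/
theorem hasComponent_of_mem_diagramGroup [P.IsReduced] {z : P.weylGroup}
    (hz : z ∈ diagramGroup b) (c : Component P) :
    HasComponent b c (z • negHighestRoot b c) z := by
  set a := z • negHighestRoot b c with ha
  obtain ⟨w, hw⟩ := exists_isLongest b c a
  obtain ⟨w₀, hw₀⟩ := exists_isLongest b c (negHighestRoot b c)
  refine ⟨w, w₀, hw, hw₀, fun j hj => ?_⟩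
  have hkey : ∀ j ∈ b.support, comp P j = c → b.IsPos ((w₀⁻¹ * (w⁻¹ * z)) • j) := by
    intro j hj hjc
    rw [mul_smul]
    apply hw₀.isPos_inv_smul
    · rw [mem_parabolicRoots_iff]
      intro l hl
      have hls : l ∈ b.support := by
        by_contra hls
        exact hl (coef_of_notMem b hls _)
      refine ⟨hls, ?_, fun h => negHighestRoot_notMem b c (h ▸ hls)⟩
      rw [comp_eq_of_coef_ne_zero b hl, comp_smul, hjc]
    · rw [mul_smul]
      have h1 : z • j ∈ extSimpleRoots b c :=
        (smul_mem_extSimpleRoots_iff hz).mpr (Or.inl ⟨hj, hjc⟩)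
      have h2 : z • j ≠ a := fun h =>
        negHighestRoot_notMem b c (smul_left_cancel z (h.trans ha) ▸ hj)
      rcases (mem_extSimpleRoots_iff b).mp h1 with ⟨h3, h4⟩ | h3
      · exact hw.not_isPos_inv_smul (simple_mem_parabolicRoots h3 h4 h2)
          (RootPairing.Base.isPos_of_mem_support h3)
      · have h4 : a ∈ extSimpleRoots b c :=
          (smul_mem_extSimpleRoots_iff hz).mpr (negHighestRoot_mem_extSimpleRoots b c)
        obtain ⟨h5, h6⟩ := ((mem_extSimpleRoots_iff b).mp h4).resolve_right
          fun h => h2 (h3.trans h.symm)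
        apply not_isPos_of_coef_neg b (j := a)
        rw [coef_smul_of_mem_reflectionSubgroup (fun h => h.2.2 rfl) (inv_mem hw.1), h3,
          coef_negHighestRoot, neg_neg_iff_pos]
        exact coef_highestRoot_pos b h5 h6
  have h1 := smul_eq_self_of_isPos_smul b c hkey hj
  rw [← mul_assoc, ← mul_inv_rev, mul_smul, inv_smul_eq_iff] at h1
  exact h1

end Longest

/-! ### The group `A_G(v)` -/

section ComponentStabilizer

variable {ι X Y : Type*} [Finite ι] [AddCommGroup X] [AddCommGroup Y]
  [Module.Free ℤ X] [Module.Finite ℤ X] [Module.Free ℤ Y] [Module.Finite ℤ Y]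
  {P : RootDatum ι X Y} [IsSemisimple P] {b : P.Base} {v : V Y}

variable (b v) in
/-- Some vector is strictly positive on `I_v`: the one pointing from `v` to an interior point of
the alcove. -/
theorem exists_pos_on_zeroSet : ∃ d : V Y, ∀ i ∈ zeroSet b v, 0 < rootEval P i d := by
  let := Fintype.ofFinite ι
  set N : ℚ := 1 + ∑ i : ι, |(b.height i : ℚ)| with hN
  have hlt : ∀ i, (b.height i : ℚ) < N := by
    intro i
    have h1 := Finset.single_le_sum (f := fun i : ι => |(b.height i : ℚ)|)
      (fun i _ => abs_nonneg _) (Finset.mem_univ i)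
    have h2 := le_abs_self (b.height i : ℚ)
    linarith
  have hN0 : 0 < N := by positivity
  obtain ⟨m, hm⟩ := exists_rootEval_eq b (P := P) fun _ => N⁻¹
  refine ⟨m - v, fun i hi => ?_⟩
  obtain ⟨h1, h2⟩ := (mem_zeroSet_iff b).mp hi
  rw [map_sub, h2, sub_pos]
  rcases (mem_extSimple_iff b).mp h1 with h | h
  · rw [shift_of_mem b h, hm i h, Int.cast_zero]
    positivity
  · have hn : i ∉ b.support := h ▸ negHighestRoot_notMem b _
    rw [shift_of_notMem b hn, h, rootEval_negHighestRoot, rootEval_eq_height_mul b hm]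
    have h3 := (mul_inv_lt_iff₀ hN0).mpr ((hlt (highestRoot b (comp P i))).trans_eq
      (one_mul N).symm)
    push_cast
    linarith

omit [Finite ι] [Module.Free ℤ X] [Module.Finite ℤ X] [Module.Free ℤ Y] [Module.Finite ℤ Y]
  [IsSemisimple P] in
theorem eval_pos_of_mem_closure {I : Set ι} {d : V Y} (hd : ∀ i ∈ I, 0 < rootEval P i d) {x : X}
    (hx : x ∈ AddSubmonoid.closure (P.root '' I)) : x = 0 ∨ 0 < evalHom P d x := by
  induction hx using AddSubmonoid.closure_induction with
  | mem x hx =>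
    obtain ⟨i, hi, rfl⟩ := hx
    exact Or.inr (hd i hi)
  | zero => exact Or.inl rfl
  | add x y _ _ hx hy =>
    rw [map_add]
    rcases hx with rfl | hx
    · rcases hy with rfl | hy
      · exact Or.inl (add_zero 0)
      · right
        rwa [map_zero, zero_add]
    · rcases hy with rfl | hy
      · right
        rwa [map_zero, add_zero]
      · exact Or.inr (add_pos hx hy)

omit [Finite ι] [Module.Free ℤ X] [Module.Finite ℤ X] [Module.Free ℤ Y] [Module.Finite ℤ Y]
  [IsSemisimple P] in
theorem rootEval_pos_of_mem_closure {I : Set ι} {d : V Y} (hd : ∀ i ∈ I, 0 < rootEval P i d)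
    {i : ι} (hi : P.root i ∈ AddSubmonoid.closure (P.root '' I)) : 0 < rootEval P i d :=
  (eval_pos_of_mem_closure hd hi).resolve_left (P.ne_zero i)

omit [Finite ι] [Module.Free ℤ X] [Module.Finite ℤ X] [Module.Free ℤ Y] [Module.Finite ℤ Y]
  [IsSemisimple P] in
theorem neg_mem_integralRoots {i : ι} (hi : i ∈ integralRoots P v) :
    P.reflectionPerm i i ∈ integralRoots P v := by
  obtain ⟨n, hn⟩ := hi
  exact ⟨-n, by rw [rootEval_neg, hn, Int.cast_neg]⟩

omit [Finite ι] [Module.Free ℤ X] [Module.Finite ℤ X] [Module.Free ℤ Y] [Module.Finite ℤ Y]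
  [IsSemisimple P] in
theorem level_neg (i : ι) : level b (P.reflectionPerm i i) = -1 - level b i := by
  by_cases hi : b.IsPos i
  · rw [level_of_isPos b hi, level_of_not_isPos b (by rwa [isPos_neg_iff, not_not])]
    norm_num
  · rw [level_of_not_isPos b hi, level_of_isPos b (by rwa [isPos_neg_iff])]
    norm_num

theorem mem_or_neg_mem_positiveIntegralRoots (hv : v ∈ alcove b) {i : ι}
    (hi : i ∈ integralRoots P v) :
    i ∈ positiveIntegralRoots b v ∨ P.reflectionPerm i i ∈ positiveIntegralRoots b v := by
  refine ((isRootBasis_zeroSet hv).2.2 i hi).imp (fun h => ⟨hi, h⟩) fun h => ?_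
  refine ⟨neg_mem_integralRoots hi, ?_⟩
  rwa [RootPairing.root_reflectionPerm, RootPairing.reflection_apply_self]

omit [Module.Free ℤ X] [Module.Finite ℤ X] [Module.Free ℤ Y] [Module.Finite ℤ Y]
  [IsSemisimple P] in
theorem level_le_rootEval (hv : v ∈ alcove b) (i : ι) : (level b i : ℚ) ≤ rootEval P i v := by
  by_cases hi : b.IsPos i
  · rw [level_of_isPos b hi, Int.cast_zero]
    exact rootEval_nonneg_of_isPos hv hi
  · have := rootEval_le_one hv (P.reflectionPerm i i)
    rw [rootEval_neg] at this
    rw [level_of_not_isPos b hi]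
    push_cast
    linarith

omit [Module.Free ℤ X] [Module.Finite ℤ X] [Module.Free ℤ Y] [Module.Finite ℤ Y]
  [IsSemisimple P] in
theorem rootEval_le_level_add_one (hv : v ∈ alcove b) (i : ι) :
    rootEval P i v ≤ level b i + 1 := by
  have := level_le_rootEval hv (P.reflectionPerm i i)
  rw [rootEval_neg, level_neg] at this
  push_cast at this
  linarith

/-- `Φ⁺(v)` consists of the roots that are as small at `v` as they can be on the alcove. -/
theorem mem_positiveIntegralRoots_iff (hv : v ∈ alcove b) {i : ι} :
    i ∈ positiveIntegralRoots b v ↔ rootEval P i v = level b i := by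
  obtain ⟨d, hd⟩ := exists_pos_on_zeroSet b v
  have hroot : ∀ j, P.root (P.reflectionPerm j j) = -P.root j := fun j => by
    rw [RootPairing.root_reflectionPerm, RootPairing.reflection_apply_self]
  have hexcl : ∀ j, P.root j ∈ AddSubmonoid.closure (P.root '' zeroSet b v) →
      -P.root j ∉ AddSubmonoid.closure (P.root '' zeroSet b v) := by
    intro j h1 h2
    rw [← hroot] at h2
    have h3 := rootEval_pos_of_mem_closure hd h1
    have h4 := rootEval_pos_of_mem_closure hd h2
    rw [rootEval_neg] at h4
    linarith
  by_cases hi : b.IsPos i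
  · rw [level_of_isPos b hi, Int.cast_zero]
    constructor
    · rintro ⟨h1, h2⟩
      rcases closure_of_isPos_integral hv hi h1 with h | h
      · exact h.1
      · exact absurd h.2 (hexcl i h2)
    · intro h
      have h1 : i ∈ integralRoots P v := ⟨0, by simpa using h⟩
      rcases closure_of_isPos_integral hv hi h1 with h' | h'
      · exact ⟨h1, h'.2⟩
      · rw [h] at h'
        exact absurd h'.1 (by norm_num)
  · rw [level_of_not_isPos b hi]
    rw [← isPos_neg_iff] at hi
    constructor
    · rintro ⟨h1, h2⟩
      rcases closure_of_isPos_integral hv hi (neg_mem_integralRoots h1) with h | h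
      · rw [hroot] at h
        exact absurd h.2 (hexcl i h2)
      · have := h.1
        rw [rootEval_neg] at this
        push_cast
        linarith
    · intro h
      have h1 : i ∈ integralRoots P v := ⟨-1, h⟩
      rcases closure_of_isPos_integral hv hi (neg_mem_integralRoots h1) with h' | h'
      · rw [rootEval_neg, h] at h'
        exact absurd h'.1 (by norm_num)
      · rw [hroot, neg_neg] at h'
        exact ⟨h1, h'.2⟩

theorem smul_mem_positiveIntegralRoots_iff {w : P.weylGroup} (hw : w ∈ componentStabilizer b v)
    {i : ι} : w • i ∈ positiveIntegralRoots b v ↔ i ∈ positiveIntegralRoots b v := by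
  have h : w • positiveIntegralRoots b v = positiveIntegralRoots b v := hw.2
  nth_rewrite 1 [← h]
  exact Set.smul_mem_smul_set_iff

omit [Finite ι] [Module.Free ℤ X] [Module.Finite ℤ X] [Module.Free ℤ Y] [Module.Finite ℤ Y]
  [IsSemisimple P] in
theorem exists_int_of_mem_weylStabilizer {w : P.weylGroup} (hw : w ∈ weylStabilizer P v) (i : ι) :
    ∃ n : ℤ, rootEval P i v - rootEval P (w • i) v = n := by
  obtain ⟨n, hn⟩ := exists_int_of_mem_lattice P
    (show weylRep P w v - v ∈ lattice Y from hw) (w • i)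
  rw [map_sub, rootEval_smul_weylRep] at hn
  exact ⟨n, hn⟩

omit [Finite ι] [Module.Free ℤ X] [Module.Finite ℤ X] [Module.Free ℤ Y] [Module.Finite ℤ Y]
  [IsSemisimple P] in
theorem smul_mem_integralRoots {w : P.weylGroup} (hw : w ∈ weylStabilizer P v) {i : ι}
    (hi : i ∈ integralRoots P v) : w • i ∈ integralRoots P v := by
  obtain ⟨n, hn⟩ := exists_int_of_mem_weylStabilizer hw i
  obtain ⟨m, hm⟩ := hi
  refine ⟨m - n, ?_⟩
  push_cast
  linarith

/-- An element of `A_G(v)` followed by the translation that brings `v` back permutes the affine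
roots that are nonnegative on the alcove: the values at `v` of a root and of its image, minus
their levels, lie in `[0, 1]`, differ by an integer, and are simultaneously equal to `0` or `1`. -/
theorem rootEval_sub_level_smul (hv : v ∈ alcove b) {w : P.weylGroup}
    (hw : w ∈ componentStabilizer b v) (i : ι) :
    rootEval P (w • i) v - level b (w • i) = rootEval P i v - level b i := by
  have hzero : ∀ j, rootEval P j v - level b j = 0 ↔ j ∈ positiveIntegralRoots b v := fun j => by
    rw [mem_positiveIntegralRoots_iff hv, sub_eq_zero]
  have hone : ∀ j, rootEval P j v - level b j = 1 ↔
      P.reflectionPerm j j ∈ positiveIntegralRoots b v := fun j => by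
    rw [mem_positiveIntegralRoots_iff hv, rootEval_neg, level_neg]
    push_cast
    constructor <;> intro h <;> linarith
  have h0 : rootEval P (w • i) v - level b (w • i) = 0 ↔ rootEval P i v - level b i = 0 := by
    rw [hzero, hzero, smul_mem_positiveIntegralRoots_iff hw]
  have h1 : rootEval P (w • i) v - level b (w • i) = 1 ↔ rootEval P i v - level b i = 1 := by
    rw [hone, hone, ← smul_neg_idx, smul_mem_positiveIntegralRoots_iff hw]
  obtain ⟨n, hn⟩ := exists_int_of_mem_weylStabilizer hw.1 i
  have hl1 := level_le_rootEval hv i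
  have hl2 := rootEval_le_level_add_one hv i
  have hl3 := level_le_rootEval hv (w • i)
  have hl4 := rootEval_le_level_add_one hv (w • i)
  set p := rootEval P (w • i) v - level b (w • i) with hp
  set q := rootEval P i v - level b i with hq
  by_cases hq0 : q = 0
  · rw [hq0, h0.mpr hq0]
  by_cases hq1 : q = 1
  · rw [hq1, h1.mpr hq1]
  have hp0 : p ≠ 0 := fun h => hq0 (h0.mp h)
  have hp1 : p ≠ 1 := fun h => hq1 (h1.mp h)
  have hq0' : 0 < q := lt_of_le_of_ne (by linarith) (Ne.symm hq0)
  have hq1' : q < 1 := lt_of_le_of_ne (by linarith) hq1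
  have hp0' : 0 < p := lt_of_le_of_ne (by linarith) (Ne.symm hp0)
  have hp1' : p < 1 := lt_of_le_of_ne (by linarith) hp1
  have hdiff : q - p = ((n - level b i + level b (w • i) : ℤ) : ℚ) := by
    push_cast
    linarith
  have h2 : n - level b i + level b (w • i) = 0 := by
    have h3 : ((n - level b i + level b (w • i) : ℤ) : ℚ) < 1 := by linarith
    have h4 : (-1 : ℚ) < ((n - level b i + level b (w • i) : ℤ) : ℚ) := by linarith
    have h3' : n - level b i + level b (w • i) < 1 := by exact_mod_cast h3
    have h4' : -1 < n - level b i + level b (w • i) := by exact_mod_cast h4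
    omega
  rw [h2, Int.cast_zero] at hdiff
  linarith

theorem mem_diagramGroup_of_mem_componentStabilizer (hv : v ∈ alcove b) {w : P.weylGroup}
    (hw : w ∈ componentStabilizer b v) : w ∈ diagramGroup b := by
  refine smul_set_eq_of_forall_mem fun i hi => ?_
  refine smul_mem_extSimple_of_level b (y := v - weylRep P w v) (fun j => ?_) hi
  rw [map_sub, rootEval_smul_weylRep]
  linarith [rootEval_sub_level_smul hv hw j]

theorem affineCoord_smul_eq_iff {z : P.weylGroup} (hz : z ∈ diagramGroup b) {i : ι}
    (hi : i ∈ extSimple b) : affineCoord b v (z • i) = affineCoord b v i ↔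
      rootEval P (z • i) v - shift b (z • i) = rootEval P i v - shift b i := by
  rw [affineCoord_of_mem b hi, affineCoord_of_mem b ((smul_mem_of_mem_diagramGroup hz).mpr hi),
    mark_smul hz hi]
  exact mul_right_inj' (by exact_mod_cast (mark_pos b i).ne')

theorem affineCoord_smul_of_mem_componentStabilizer (hv : v ∈ alcove b) {w : P.weylGroup}
    (hw : w ∈ componentStabilizer b v) {i : ι} (hi : i ∈ extSimple b) :
    affineCoord b v (w • i) = affineCoord b v i := by
  have hz := mem_diagramGroup_of_mem_componentStabilizer hv hw
  rw [affineCoord_smul_eq_iff hz hi, shift_eq_level b hi,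
    shift_eq_level b ((smul_mem_of_mem_diagramGroup hz).mpr hi)]
  exact rootEval_sub_level_smul hv hw i

/-- If `z ∈ 𝒜` preserves the affine coordinates of `v`, then `z v + ϖ^∨(z) = v`. -/
theorem weylRep_sub_eq {z : P.weylGroup} (hz : z ∈ diagramGroup b)
    (h : ∀ i ∈ extSimple b, affineCoord b v (z • i) = affineCoord b v i) :
    weylRep P z v - v = -∑ᶠ c, fundamentalCoweight b (z • negHighestRoot b c) := by
  apply ext_rootEval b
  intro i hi
  have hi' := mem_extSimple_of_mem b hi
  have hzi : z⁻¹ • i ∈ extSimple b := (smul_mem_of_mem_diagramGroup (inv_mem hz)).mpr hi'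
  have h1 := (affineCoord_smul_eq_iff hz hzi).mp (h _ hzi)
  rw [smul_inv_smul] at h1
  rw [map_sub, map_neg, rootEval_weylRep, rootEval_sum_fundamentalCoweight hz hi']
  linarith

theorem smul_mem_zeroSet {z : P.weylGroup} (hz : z ∈ diagramGroup b)
    (h : ∀ i ∈ extSimple b, affineCoord b v (z • i) = affineCoord b v i) {i : ι}
    (hi : i ∈ zeroSet b v) : z • i ∈ zeroSet b v :=
  ⟨(smul_mem_of_mem_diagramGroup hz).mpr hi.1, (h i hi.1).trans hi.2⟩

theorem componentStabilizer_eq [P.IsReduced] (hv : v ∈ alcove b) :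
    (componentStabilizer b v : Set P.weylGroup) = {z ∈ diagramGroupOf b |
      ∀ i ∈ extSimple b, affineCoord b v (z • i) = affineCoord b v i} := by
  ext z
  constructor
  · intro hz
    have hdiag := mem_diagramGroup_of_mem_componentStabilizer hv hz
    have hcoord : ∀ i ∈ extSimple b, affineCoord b v (z • i) = affineCoord b v i :=
      fun i hi => affineCoord_smul_of_mem_componentStabilizer hv hz hi
    refine ⟨⟨hdiag, fun c => z • negHighestRoot b c, fun c => ⟨⟨?_, ?_⟩, ?_⟩, ?_⟩, hcoord⟩
    · exact (smul_mem_extSimpleRoots_iff hdiag).mpr (negHighestRoot_mem_extSimpleRoots b c)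
    · rw [mark_smul hdiag (negHighestRoot_mem b c), mark_of_notMem b (negHighestRoot_notMem b c)]
    · exact hasComponent_of_mem_diagramGroup hdiag c
    · have h1 : weylRep P z v - v ∈ lattice Y := hz.1
      rw [weylRep_sub_eq hdiag hcoord] at h1
      exact neg_mem_iff.mp h1
  · rintro ⟨⟨hdiag, α, hα, hsum⟩, hcoord⟩
    have hα' : α = fun c => z • negHighestRoot b c :=
      funext fun c => ((hα c).2.smul_negHighestRoot (hα c).1).symm
    have hstab : z ∈ weylStabilizer P v := by
      change weylRep P z v - v ∈ lattice Y
      rw [weylRep_sub_eq hdiag hcoord, neg_mem_iff]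
      rwa [hα'] at hsum
    refine ⟨hstab, smul_set_eq_of_forall_mem fun i hi => ?_⟩
    refine ⟨smul_mem_integralRoots hstab hi.1, ?_⟩
    rw [root_smul]
    have h1 : ∀ x ∈ AddSubmonoid.closure (P.root '' zeroSet b v),
        z • x ∈ AddSubmonoid.closure (P.root '' zeroSet b v) := by
      intro x hx
      induction hx using AddSubmonoid.closure_induction with
      | mem x hx =>
        obtain ⟨j, hj, rfl⟩ := hx
        rw [← root_smul]
        exact AddSubmonoid.subset_closure (Set.mem_image_of_mem _ (smul_mem_zeroSet hdiag hcoord hj))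
      | zero => rw [smul_zero]; exact zero_mem _
      | add x y _ _ hx hy => rw [smul_add]; exact add_mem hx hy
    exact h1 _ hi.2

end ComponentStabilizer

/-! ### Isolated and quasi-isolated elements -/

section Isolated

variable {ι X Y : Type*} [Finite ι] [AddCommGroup X] [AddCommGroup Y]
  [Module.Free ℤ X] [Module.Finite ℤ X] [Module.Free ℤ Y] [Module.Finite ℤ Y]
  {P : RootDatum ι X Y} [IsSemisimple P] {b : P.Base} {v : V Y}

theorem weylStabilizerZero_fixes_iff (hv : v ∈ alcove b) {x : V Y} :
    (∀ w ∈ weylStabilizerZero P v, weylRep P w x = x) ↔ ∀ i ∈ zeroSet b v, rootEval P i x = 0 := by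
  constructor
  · intro h i hi
    rw [← weylRep_ofIdx_eq_self_iff]
    exact h _ (ofIdx_mem_reflectionSubgroup (zeroSet_subset_integralRoots b v hi))
  · intro h w hw
    refine weylRep_eq_self_of_mem_reflectionSubgroup (fun i hi => ?_) hw
    have hcl : AddSubmonoid.closure (P.root '' zeroSet b v) ≤ AddMonoidHom.mker (evalHom P x) := by
      rw [AddSubmonoid.closure_le]
      rintro _ ⟨j, hj, rfl⟩
      exact h j hj
    rcases (isRootBasis_zeroSet hv).2.2 i hi with h1 | h1
    · exact hcl h1
    · have h2 : evalHom P x (-P.root i) = 0 := hcl h1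
      rwa [map_neg, neg_eq_zero] at h2

omit [Finite ι] [Module.Free ℤ X] [Module.Finite ℤ X] [Module.Free ℤ Y] [Module.Finite ℤ Y]
  [IsSemisimple P] in
theorem weylStabilizerZero_le : weylStabilizerZero P v ≤ weylStabilizer P v := by
  refine reflectionSubgroup_le fun i hi => ?_
  obtain ⟨n, hn⟩ := hi
  change weylRep P _ v - v ∈ lattice Y
  rw [weylRep_ofIdx, hn, sub_sub_cancel_left, neg_mem_iff, Int.cast_smul_eq_zsmul]
  exact zsmul_mem (coroot_mem_lattice P i) n

/-- `W_G(v)` is generated by `W°(v)` and `A_G(v)`, since `W°(v)` acts transitively on the positive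
systems of `Φ(v)`. -/
theorem exists_mul_mem_componentStabilizer (hv : v ∈ alcove b) {w : P.weylGroup}
    (hw : w ∈ weylStabilizer P v) :
    ∃ u ∈ weylStabilizerZero P v, u * w ∈ componentStabilizer b v := by
  obtain ⟨d, hd⟩ := exists_pos_on_zeroSet b v
  obtain ⟨u, hu, hnn⟩ := exists_weylRep_nonneg (I := zeroSet b v) (H := weylStabilizerZero P v)
    (fun i hi => ofIdx_mem_reflectionSubgroup (zeroSet_subset_integralRoots b v hi)) hd
    (weylRep P w d)
  have huw : u * w ∈ weylStabilizer P v := mul_mem (weylStabilizerZero_le hu) hw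
  have hstab : (u * w)⁻¹ ∈ MulAction.stabilizer P.weylGroup (positiveIntegralRoots b v) := by
    refine smul_set_eq_of_forall_mem fun i hi => ?_
    have h1 := smul_mem_integralRoots (inv_mem huw) hi.1
    refine (mem_or_neg_mem_positiveIntegralRoots hv h1).resolve_right fun h2 => ?_
    have h3 := rootEval_pos_of_mem_closure hd h2.2
    rw [rootEval_neg, ← rootEval_weylRep, weylRep_mul_apply] at h3
    have h4 : ∀ x ∈ AddSubmonoid.closure (P.root '' zeroSet b v),
        0 ≤ evalHom P (weylRep P u (weylRep P w d)) x := by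
      intro x hx
      induction hx using AddSubmonoid.closure_induction with
      | mem x hx =>
        obtain ⟨j, hj, rfl⟩ := hx
        exact hnn j hj
      | zero => rw [map_zero]
      | add x y _ _ hx hy => rw [map_add]; exact add_nonneg hx hy
    have h5 := h4 _ hi.2
    rw [evalHom_root] at h5
    linarith
  exact ⟨u, hu, huw, (inv_mem_iff (H := MulAction.stabilizer P.weylGroup _)).mp hstab⟩

theorem weylStabilizer_fixes_iff (hv : v ∈ alcove b) {x : V Y} :
    (∀ w ∈ weylStabilizer P v, weylRep P w x = x) ↔
      (∀ i ∈ zeroSet b v, rootEval P i x = 0) ∧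
        ∀ z ∈ componentStabilizer b v, weylRep P z x = x := by
  rw [← weylStabilizerZero_fixes_iff hv]
  constructor
  · intro h
    exact ⟨fun w hw => h w (weylStabilizerZero_le hw), fun z hz => h z hz.1⟩
  · rintro ⟨h1, h2⟩ w hw
    obtain ⟨u, hu, huw⟩ := exists_mul_mem_componentStabilizer hv hw
    have h3 := h2 _ huw
    rw [weylRep_mul_apply] at h3
    rw [← weylRep_inv_apply u (weylRep P w x), h3]
    exact h1 _ (inv_mem hu)

variable (b) in
/-- Prescribed values on `Δ̃` are attained by a vector when they satisfy the linear relations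
between the elements of `Δ̃`. -/
theorem exists_rootEval_extSimple {f : ι → ℚ}
    (hf : ∀ c : Component P, ∑ i ∈ extFinset b c, (mark b i : ℚ) * f i = 0) :
    ∃ x : V Y, ∀ i ∈ extSimple b, rootEval P i x = f i := by
  obtain ⟨x, hx⟩ := exists_rootEval_eq b f
  refine ⟨x, fun i hi => ?_⟩
  rcases (mem_extSimple_iff b).mp hi with h | h
  · exact hx i h
  · have h1 := hf (comp P i)
    rw [sum_extFinset_mark, ← h, Finset.sum_congr rfl fun j hj => by rw [← hx j hj],
      ← rootEval_eq_sum_coef] at h1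
    nth_rewrite 1 [h]
    rw [rootEval_negHighestRoot]
    linarith

/-- Let `A` be a group of diagram automorphisms preserving `I_v`. A vector orthogonal to `I_v` and
fixed by `A` is a family of values on `Δ̃` vanishing on `I_v`, constant on the orbits of `A`, and
satisfying the relation `∑ n_α ⟨α, x⟩ = 0` for each component. Such a nonzero family exists if and
only if `A` has at least two orbits on some `Δ̃_c \ I_v`. -/
theorem forall_eq_zero_iff_transitive {A : Subgroup P.weylGroup} (hA : A ≤ diagramGroup b)
    (hAI : ∀ z ∈ A, ∀ i ∈ zeroSet b v, z • i ∈ zeroSet b v) :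
    (¬ ∃ x : V Y, x ≠ 0 ∧ (∀ i ∈ zeroSet b v, rootEval P i x = 0) ∧
        ∀ z ∈ A, weylRep P z x = x) ↔
      ∀ c : Component P, ∀ i ∈ extSimpleRoots b c \ zeroSet b v,
        ∀ j ∈ extSimpleRoots b c \ zeroSet b v, ∃ z ∈ A, z • i = j := by
  classical
  have hmark : ∀ i, (0 : ℚ) < mark b i := fun i => by exact_mod_cast mark_pos b i
  constructor
  · intro h c i hi j hj
    by_contra hij
    let O : ι → ι → Prop := fun k l => ∃ z ∈ A, z • k = l
    have hO : ∀ k, O k k := fun k => ⟨1, one_mem _, one_smul _ k⟩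
    have hOsmul : ∀ k l, ∀ z ∈ A, (O k (z • l) ↔ O k l) := by
      intro k l z hz
      constructor
      · rintro ⟨u, hu, h⟩
        exact ⟨z⁻¹ * u, mul_mem (inv_mem hz) hu, by rw [mul_smul, h, inv_smul_smul]⟩
      · rintro ⟨u, hu, rfl⟩
        exact ⟨z * u, mul_mem hz hu, mul_smul z u k⟩
    have hOcomp : ∀ k l, O k l → comp P l = comp P k := by
      rintro k _ ⟨z, -, rfl⟩
      exact comp_smul z k
    have hOI : ∀ k, k ∉ zeroSet b v → ∀ l, O k l → l ∉ zeroSet b v := by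
      rintro k hk _ ⟨z, hz, rfl⟩ hl
      have := hAI z⁻¹ (inv_mem hz) _ hl
      rw [inv_smul_smul] at this
      exact hk this
    let S : ι → ℚ := fun k => ∑ l ∈ extFinset b c, if O k l then (mark b l : ℚ) else 0
    have hS : ∀ k ∈ extSimpleRoots b c, 0 < S k := by
      intro k hk
      refine Finset.sum_pos' (fun l _ => ?_) ⟨k, (mem_extFinset b).mpr hk, ?_⟩
      · split_ifs
        · exact (hmark l).le
        · exact le_rfl
      · rw [if_pos (hO k)]
        exact hmark k
    have hnij : ¬ O i j := hij
    have hnji : ¬ O j i := by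
      rintro ⟨z, hz, h⟩
      exact hij ⟨z⁻¹, inv_mem hz, by rw [← h, inv_smul_smul]⟩
    let f : ι → ℚ := fun k => (if O i k then S j else 0) - (if O j k then S i else 0)
    have hic := comp_of_mem_extSimpleRoots b hi.1
    have hjc := comp_of_mem_extSimpleRoots b hj.1
    have hf : ∀ d : Component P, ∑ k ∈ extFinset b d, (mark b k : ℚ) * f k = 0 := by
      intro d
      by_cases hd : d = c
      · have h1 : ∀ k, (mark b k : ℚ) * f k = (if O i k then (mark b k : ℚ) else 0) * S j -
            (if O j k then (mark b k : ℚ) else 0) * S i := by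
          intro k
          simp only [f]
          split_ifs <;> ring
        rw [Finset.sum_congr rfl fun k _ => h1 k, Finset.sum_sub_distrib, ← Finset.sum_mul,
          ← Finset.sum_mul, hd]
        change S i * S j - S j * S i = 0
        ring
      · refine Finset.sum_eq_zero fun k hk => ?_
        have hkd := comp_of_mem_extSimpleRoots b ((mem_extFinset b).mp hk)
        have h1 : ¬ O i k := fun h => hd (by rw [← hkd, hOcomp i k h, hic])
        have h2 : ¬ O j k := fun h => hd (by rw [← hkd, hOcomp j k h, hjc])
        simp [f, h1, h2]
    obtain ⟨x, hx⟩ := exists_rootEval_extSimple b hf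
    refine h ⟨x, ?_, fun k hk => ?_, fun z hz => ?_⟩
    · rintro rfl
      have h1 := hx i ((mem_extSimpleRoots_iff' b).mp hi.1).1
      simp only [f, map_zero, if_pos (hO i), if_neg hnji, sub_zero] at h1
      exact (hS j hj.1).ne h1
    · rw [hx k hk.1]
      have h1 : ¬ O i k := fun h => hOI i hi.2 k h hk
      have h2 : ¬ O j k := fun h => hOI j hj.2 k h hk
      simp [f, h1, h2]
    · apply ext_rootEval b
      intro k hk
      have hk' := mem_extSimple_of_mem b hk
      rw [rootEval_weylRep, hx k hk',
        hx _ ((smul_mem_of_mem_diagramGroup (inv_mem (hA hz))).mpr hk')]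
      simp only [f, hOsmul _ _ _ (inv_mem hz)]
  · rintro h ⟨x, hx0, hxI, hxA⟩
    have hext : ∀ k ∈ extSimple b, rootEval P k x = 0 := by
      intro k hk
      by_cases hkI : k ∈ zeroSet b v
      · exact hxI k hkI
      set c := comp P k with hc
      have hkc : k ∈ extSimpleRoots b c := (mem_extSimpleRoots_iff' b).mpr ⟨hk, rfl⟩
      have h1 : ∀ i ∈ extFinset b c, (mark b i : ℚ) * rootEval P i x =
          (if i ∈ zeroSet b v then 0 else (mark b i : ℚ)) * rootEval P k x := by
        intro i hi
        rw [mem_extFinset] at hi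
        split_ifs with hiI
        · rw [hxI i hiI, mul_zero, zero_mul]
        · obtain ⟨z, hz, rfl⟩ := h c k ⟨hkc, hkI⟩ i ⟨hi, hiI⟩
          nth_rewrite 1 [← hxA z hz]
          rw [rootEval_smul_weylRep]
      have h2 := sum_extFinset_mark_rootEval b c x
      rw [Finset.sum_congr rfl h1, ← Finset.sum_mul, mul_eq_zero] at h2
      refine h2.resolve_left (ne_of_gt ?_)
      refine Finset.sum_pos' (fun i _ => ?_) ⟨k, (mem_extFinset b).mpr hkc, ?_⟩
      · split_ifs
        · exact le_rfl
        · exact (hmark i).le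
      · rw [if_neg hkI]
        exact hmark k
    exact hx0 (eq_zero_of_rootEval P b x fun i hi => hext i (mem_extSimple_of_mem b hi))

theorem isIsolated_iff [P.IsReduced] (hv : v ∈ alcove b) :
    IsIsolated b v ↔ ∀ c : Component P, (extSimpleRoots b c \ zeroSet b v).ncard = 1 := by
  have h1 := forall_eq_zero_iff_transitive (b := b) (v := v) (A := ⊥) bot_le
    fun z hz i hi => by rwa [Subgroup.mem_bot.mp hz, one_smul]
  have h2 : IsIsolated b v ↔ ¬ ∃ x : V Y, x ≠ 0 ∧ (∀ i ∈ zeroSet b v, rootEval P i x = 0) ∧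
      ∀ z ∈ (⊥ : Subgroup P.weylGroup), weylRep P z x = x := by
    rw [IsIsolated, exists_isParabolic_iff]
    simp only [weylStabilizerZero_fixes_iff hv, Subgroup.mem_bot, forall_eq, map_one,
      Module.End.one_apply, and_true]
  rw [h2, h1]
  refine forall_congr' fun c => ?_
  rw [Set.ncard_eq_one]
  constructor
  · intro h
    obtain ⟨i, hi, hiI⟩ := exists_mem_extSimpleRoots_notMem_zeroSet b v c
    refine ⟨i, Set.eq_singleton_iff_unique_mem.mpr ⟨⟨hi, hiI⟩, fun j hj => ?_⟩⟩
    obtain ⟨z, hz, hzi⟩ := h i ⟨hi, hiI⟩ j hj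
    rw [← hzi, Subgroup.mem_bot.mp hz, one_smul]
  · rintro ⟨k, hk⟩ i hi j hj
    rw [hk, Set.mem_singleton_iff] at hi hj
    exact ⟨1, one_mem _, by rw [hi, hj, one_smul]⟩

theorem isQuasiIsolated_iff [P.IsReduced] (hv : v ∈ alcove b) :
    IsQuasiIsolated b v ↔ ∀ c : Component P, ∀ i ∈ extSimpleRoots b c \ zeroSet b v,
      ∀ j ∈ extSimpleRoots b c \ zeroSet b v, ∃ z ∈ componentStabilizer b v, z • i = j := by
  have hA : componentStabilizer b v ≤ diagramGroup b := fun z hz =>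
    mem_diagramGroup_of_mem_componentStabilizer hv hz
  rw [IsQuasiIsolated, exists_isParabolic_iff, ← forall_eq_zero_iff_transitive hA
    fun z hz i hi => smul_mem_zeroSet (hA hz)
      (fun j hj => affineCoord_smul_of_mem_componentStabilizer hv hz hj) hi]
  simp only [weylStabilizer_fixes_iff hv]

end Isolated

end QuasiIsolated

end

theorem mainTheorem8 {ι X Y : Type*} [Finite ι] [AddCommGroup X] [AddCommGroup Y]
    [Module.Free ℤ X] [Module.Finite ℤ X] [Module.Free ℤ Y] [Module.Finite ℤ Y]
    (P : RootDatum ι X Y) [P.IsReduced] [QuasiIsolated.IsSemisimple P] (b : P.Base)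
    (v : QuasiIsolated.V Y) (hv : v ∈ QuasiIsolated.alcove b) :
    -- the affine coordinates exist and are unique
    (∀ a : ι → ℚ, QuasiIsolated.IsAffineCoord b v a ↔ a = QuasiIsolated.affineCoord b v) ∧
    -- the two descriptions of the set `I_v`
    QuasiIsolated.zeroSet b v = {i ∈ QuasiIsolated.extSimple b |
      QuasiIsolated.rootEval P i v = QuasiIsolated.shift b i} ∧
    -- `I_v` is a basis of `Φ(v)`
    QuasiIsolated.IsRootBasis P (QuasiIsolated.zeroSet b v) (QuasiIsolated.integralRoots P v) ∧
    -- the description of `A_G(v)`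
    (QuasiIsolated.componentStabilizer b v : Set P.weylGroup) =
      {z ∈ QuasiIsolated.diagramGroupOf b | ∀ i ∈ QuasiIsolated.extSimple b,
        QuasiIsolated.affineCoord b v (z • i) = QuasiIsolated.affineCoord b v i} ∧
    -- the criterion for `v` to be isolated
    (QuasiIsolated.IsIsolated b v ↔ ∀ c : QuasiIsolated.Component P,
      (QuasiIsolated.extSimpleRoots b c \ QuasiIsolated.zeroSet b v).ncard = 1) ∧
    -- the criterion for `v` to be quasi-isolated
    (QuasiIsolated.IsQuasiIsolated b v ↔ ∀ c : QuasiIsolated.Component P,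
      ∀ i ∈ QuasiIsolated.extSimpleRoots b c \ QuasiIsolated.zeroSet b v,
      ∀ j ∈ QuasiIsolated.extSimpleRoots b c \ QuasiIsolated.zeroSet b v,
        ∃ z ∈ QuasiIsolated.componentStabilizer b v, z • i = j) := by
  exact ⟨QuasiIsolated.isAffineCoord_iff_eq b v, QuasiIsolated.zeroSet_eq b v,
    QuasiIsolated.isRootBasis_zeroSet hv, QuasiIsolated.componentStabilizer_eq hv,
    QuasiIsolated.isIsolated_iff hv, QuasiIsolated.isQuasiIsolated_iff hv⟩
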